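/- Let $\alpha_1,\alpha_2$ be the simple roots of $G_2$, $\alpha_2$ being the longer one, with fundamental weights $\varpi_1=2\alpha_1+\alpha_2$, $\varpi_2=3\alpha_1+2\alpha_2$; let $\rho$ be the half-sum of the positive roots, $W$ the Weyl group, $\mathrm{sgn}(w)=\det w$, and $w_\ell=-1$ the longest element of $W$. Let $K$ be a field and $q,x,y\in K$ nonzero. Put $\mathbf x^{m_1\alpha_1+m_2\alpha_2}=x^{m_1}y^{m_2}$, assume that $\mathbf x^{\alpha}\ne1$ for every positive root $\alpha$ (for example, $q,x,y$ are indeterminates and $K=\mathbb C(q,x,y)$), and let $$D(\mathbf x)=\prod_{\alpha>0}\Bigl(1-\frac{\mathbf x^{\alpha}}q\Bigr)=\Bigl(1-\frac xq\Bigr)\Bigl(1-\frac yq\Bigr)\Bigl(1-\frac{xy}q\Bigr)\Bigl(1-\frac{x^2y}q\Bigr)\Bigl(1-\frac{x^3y}q\Bigr)\Bigl(1-\frac{x^3y^2}q\Bigr).$$ Let $\theta$ be a dominant weight and write $\theta+\rho=\ell_1\varpi_1+\ell_2\varpi_2$ with positive integers $\ell_1,\ell_2$. Let $\mathcal B(\theta+\rho)$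 be the set of Littelmann patterns, i.e. of 6-tuples $\pi=(a,b,c,d,e,f)$ of non-negative integers with 1. $0\le f\le \ell_2+a-2b+c-2d+e$, 2. $b\le a\le \ell_1+3b-2c+3d-2e$, 3. $\frac c2\le b\le \ell_2+c-2d+e$, 4. $2d\le c\le \ell_1+3d-2e$, 5. $e\le d\le \ell_2+e$, 6. $0\le e\le \ell_1$. An entry $u$ of $\pi$ is called *circled* (written $u^\circ$) if it equals the lower bound in its inequality, *boxed* (written $\underline u$) if it equals the upper bound; an undecorated $u$ in the list below means an entry that is neither circled nor boxed. Put $$h(u)=\begin{cases}1-\frac1q & u\text{ neither boxed nor circled},\\ -\frac1q & u\text{ boxed but not circled},\\ 1 & u\text{ circled but not boxed},\\ 0 & u\text{ both boxed and circled,}\end{cases}$$ and $\hat H(\pi)=H_{\mathrm{std}}(\pi)+H_{\mathrm{adj}}(\pi)$, where $H_{\mathrm{std}}(\pi)=h(a)h(b)h(c)h(d)h(e)h(f)$ and $H_{\mathrm{adj}}(\pi)=H_{\mathrm{adj}}(\pi')\,h(f)$. Here $H_{\mathrm{adj}}(\pi')=0$ unless $b=d+1$ and $c=2d+1$, in which case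 $$H_{\mathrm{adj}}(\pi')=\begin{cases} \frac{1-1/q}{q}, & (e^\circ,d^\circ,a^\circ)\\ -\frac{1-1/q}{q^2}, & (e^\circ,\,d\text{ or }d^\circ,\,\underline a)\\ \frac{1-1/q}{q^3}, & (e\text{ or }e^\circ,\,\underline d),\ a=2d+1-e\\ \frac{(1-1/q)^2}{q}, & (e,d^\circ,a^\circ),(e^\circ,d^\circ,a),(e^\circ,d,a^\circ),(e,d^\circ,a),(e,d,a^\circ)\\ -\frac{(1-1/q)^2}{q^2}, & (e\text{ or }e^\circ,\,\underline d,\,a),\ a\ne 2d+1-e\\ \frac{(1-1/q)^3}{q}, & (e,d,a)\\ \frac{(1-1/q)^3}{q}, & (e^\circ,d,a),\ a\ne 2d+1-e\\ \frac{1-1/q}{q}\bigl((1-\frac1q)^2+\frac1q\bigr), & (e^\circ,d),\ a=2d+1-e\\ 0, & \text{in all other cases.} \end{cases}$$ Then $$\sum_{\pi\in\mathcal B(\theta+\rho)}\hat H(\pi)\,x^{a+c+e}y^{b+d+f}=\mathbf x^{-w_\ell(\theta+\rho)}\,D(\mathbf x)\,\frac{\sum_{w\in W}\mathrm{sgn}(w)\,\mathbf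 x^{w(\theta+\rho)}}{\prod_{\alpha>0}(1-\mathbf x^{\alpha})}.$$ -/

import Mathlib

/-! ### The root system `G₂` -/

/-- The weight lattice of `G₂`, which coincides with the root lattice: the pair `(m₁, m₂)` stands
for `m₁ α₁ + m₂ α₂`, where `α₁` is the short and `α₂` the long simple root. -/
abbrev G2Weight : Type := ℤ × ℤ

namespace G2

/-- The short simple root. -/
def α₁ : G2Weight := (1, 0)

/-- The long simple root. -/
def α₂ : G2Weight := (0, 1)

/-- Pairing with the simple coroot of `α₁`: `⟨α₁, α₁^∨⟩ = 2`, `⟨α₂, α₁^∨⟩ = -3`. -/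
def coroot₁ : Module.Dual ℤ G2Weight :=
  (2 : ℤ) • LinearMap.fst ℤ ℤ ℤ - (3 : ℤ) • LinearMap.snd ℤ ℤ ℤ

/-- Pairing with the simple coroot of `α₂`: `⟨α₁, α₂^∨⟩ = -1`, `⟨α₂, α₂^∨⟩ = 2`. -/
def coroot₂ : Module.Dual ℤ G2Weight :=
  (2 : ℤ) • LinearMap.snd ℤ ℤ ℤ - LinearMap.fst ℤ ℤ ℤ

theorem coroot₁_apply (v : G2Weight) : coroot₁ v = 2 * v.1 - 3 * v.2 := by
  simp [coroot₁]

theorem coroot₂_apply (v : G2Weight) : coroot₂ v = 2 * v.2 - v.1 := by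
  simp [coroot₂]

theorem coroot₁_α₁ : coroot₁ α₁ = 2 := by simp [coroot₁_apply, α₁]

theorem coroot₂_α₂ : coroot₂ α₂ = 2 := by simp [coroot₂_apply, α₂]

/-- The simple reflection `v ↦ v - ⟨v, α₁^∨⟩ α₁`. -/
def s₁ : G2Weight ≃ₗ[ℤ] G2Weight := Module.reflection coroot₁_α₁

/-- The simple reflection `v ↦ v - ⟨v, α₂^∨⟩ α₂`. -/
def s₂ : G2Weight ≃ₗ[ℤ] G2Weight := Module.reflection coroot₂_α₂

theorem s₁_apply (v : G2Weight) : s₁ v = (-v.1 + 3 * v.2, v.2) := by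
  rw [s₁, Module.reflection_apply, coroot₁_apply]
  ext <;> simp [α₁]
  ring

theorem s₂_apply (v : G2Weight) : s₂ v = (v.1, v.1 - v.2) := by
  rw [s₂, Module.reflection_apply, coroot₂_apply]
  ext <;> simp [α₂]
  ring

/-- The Weyl group, generated by the two simple reflections. -/
def weylGroup : Subgroup (G2Weight ≃ₗ[ℤ] G2Weight) := Subgroup.closure {s₁, s₂}

/-- The six positive roots. -/
def posRoots : Finset G2Weight :=
  {(1, 0), (0, 1), (1, 1), (2, 1), (3, 1), (3, 2)}

/-- All twelve roots. -/
def roots : Finset G2Weight := posRoots ∪ posRoots.image (fun v => -v)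

theorem weyl_mem_roots {w : G2Weight ≃ₗ[ℤ] G2Weight} (hw : w ∈ weylGroup) :
    ∀ v ∈ roots, w v ∈ roots := by
  induction hw using Subgroup.closure_induction'' with
  | mem g hg =>
    rcases hg with rfl | rfl
    · simp only [s₁_apply]; decide
    · simp only [s₂_apply]; decide
  | inv_mem g hg =>
    have h1 : s₁⁻¹ = s₁ := by
      rw [inv_eq_iff_mul_eq_one]; ext v <;> simp [s₁_apply]
    have h2 : s₂⁻¹ = s₂ := by
      rw [inv_eq_iff_mul_eq_one]; ext v <;> simp [s₂_apply]
    rcases hg with rfl | rfl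
    · rw [h1]; simp only [s₁_apply]; decide
    · rw [h2]; simp only [s₂_apply]; decide
  | one => intro v hv; simpa using hv
  | mul g h _ _ hg hh => intro v hv; simpa using hg _ (hh _ hv)

/-- The roots are exactly the images of the simple roots under the Weyl group. -/
theorem mem_roots_iff (v : G2Weight) :
    v ∈ roots ↔ ∃ w ∈ weylGroup, v = w α₁ ∨ v = w α₂ := by
  have m1 : s₁ ∈ weylGroup := Subgroup.subset_closure (by simp)
  have m2 : s₂ ∈ weylGroup := Subgroup.subset_closure (by simp)
  constructor
  · intro hv
    have step : ∀ u : G2Weight, ∀ g ∈ weylGroup,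
        (∃ w ∈ weylGroup, u = w α₁ ∨ u = w α₂) →
        ∃ w ∈ weylGroup, g u = w α₁ ∨ g u = w α₂ := by
      rintro u g hg ⟨w, hw, h⟩
      refine ⟨g * w, mul_mem hg hw, ?_⟩
      rcases h with rfl | rfl
      · left; rfl
      · right; rfl
    have a10 : ∃ w ∈ weylGroup, ((1, 0) : G2Weight) = w α₁ ∨ ((1, 0) : G2Weight) = w α₂ :=
      ⟨1, one_mem _, Or.inl rfl⟩
    have a01 : ∃ w ∈ weylGroup, ((0, 1) : G2Weight) = w α₁ ∨ ((0, 1) : G2Weight) = w α₂ :=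
      ⟨1, one_mem _, Or.inr rfl⟩
    have a11 := step _ _ m2 a10
    have a21 := step _ _ m1 a11
    have a31 := step _ _ m1 a01
    have a32 := step _ _ m2 a31
    have n10 := step _ _ m1 a10
    have n01 := step _ _ m2 a01
    have n11 := step _ _ m2 n10
    have n21 := step _ _ m1 n11
    have n31 := step _ _ m1 n01
    have n32 := step _ _ m2 n31
    simp only [s₁_apply, s₂_apply] at a11 a21 a31 a32 n10 n01 n11 n21 n31 n32
    norm_num at a11 a21 a31 a32 n10 n01 n11 n21 n31 n32
    simp only [roots, posRoots, Finset.mem_union, Finset.mem_insert, Finset.mem_singleton,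
      Finset.image_insert, Finset.image_singleton] at hv
    rcases hv with (rfl | rfl | rfl | rfl | rfl | rfl) | (rfl | rfl | rfl | rfl | rfl | rfl)
    · exact a10
    · exact a01
    · simpa using a11
    · simpa using a21
    · simpa using a31
    · simpa using a32
    · simpa using n10
    · simpa using n01
    · simpa using n11
    · simpa using n21
    · simpa using n31
    · simpa using n32
  · rintro ⟨w, hw, rfl | rfl⟩
    · exact weyl_mem_roots hw _ (by decide)
    · exact weyl_mem_roots hw _ (by decide)

/-- The positive roots are the roots with nonnegative coordinates in the simple roots. -/
theorem mem_posRoots_iff (v : G2Weight) : v ∈ posRoots ↔ v ∈ roots ∧ 0 ≤ v.1 ∧ 0 ≤ v.2 := by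
  constructor
  · intro h
    refine ⟨Finset.mem_union_left _ h, ?_⟩
    revert v; decide
  · rintro ⟨h, h'⟩
    revert v; decide

instance : Finite weylGroup := by
  refine Finite.of_injective
    (β := roots × roots)
    (fun w => (⟨w.1 α₁, weyl_mem_roots w.2 _ (by decide)⟩,
      ⟨w.1 α₂, weyl_mem_roots w.2 _ (by decide)⟩)) ?_
  intro w w' h
  simp only [Prod.mk.injEq, Subtype.mk.injEq] at h
  apply Subtype.ext
  apply LinearEquiv.ext
  intro v
  have hv : v = v.1 • α₁ + v.2 • α₂ := by ext <;> simp [α₁, α₂]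
  rw [hv, map_add, map_add, map_smul, map_smul, map_smul, map_smul, h.1, h.2]

noncomputable instance : Fintype weylGroup := Fintype.ofFinite _

/-- The sign `sgn(w)` of a Weyl group element, its determinant. -/
noncomputable def sgn (w : weylGroup) : ℤ := ((LinearEquiv.det w.1 : ℤˣ) : ℤ)

/-- The longest element `w_ℓ` of the Weyl group of `G₂`, which acts as `-1`. -/
def longest : weylGroup :=
  ⟨LinearEquiv.neg ℤ, by
    have m1 : s₁ ∈ weylGroup := Subgroup.subset_closure (by simp)
    have m2 : s₂ ∈ weylGroup := Subgroup.subset_closure (by simp)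
    have h : (LinearEquiv.neg ℤ : G2Weight ≃ₗ[ℤ] G2Weight) = (s₁ * s₂) ^ 3 := by
      apply LinearEquiv.ext
      intro v
      simp only [pow_succ, pow_zero, one_mul, LinearEquiv.mul_apply, s₁_apply, s₂_apply,
        LinearEquiv.neg_apply]
      ext <;> simp <;> ring
    rw [h]
    exact pow_mem (mul_mem m1 m2) 3⟩

/-- The longest element is the one that makes every positive root negative. -/
theorem eq_longest_iff (w : weylGroup) : w = longest ↔ ∀ v ∈ posRoots, -(w.1 v) ∈ posRoots := by
  constructor
  · rintro rfl v hv
    simpa [longest] using hv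
  · intro h
    have h1 := h α₁ (by decide)
    have h2 := h α₂ (by decide)
    have h3 := h (3, 2) (by decide)
    have h4 := h (3, 1) (by decide)
    have e : ∀ a b : ℤ, w.1 (a, b) = a • w.1 α₁ + b • w.1 α₂ := by
      intro a b
      rw [← map_smul, ← map_smul, ← map_add]
      congr 1
      ext <;> simp [α₁, α₂]
    rw [e] at h3 h4
    have key : ∀ p ∈ posRoots, ∀ r ∈ posRoots, ((3 : ℤ) • p + (2 : ℤ) • r) ∈ posRoots →
        p = α₁ ∧ r = α₂ := by decide
    have hk := key _ h1 _ h2 (by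
      have : (3 : ℤ) • -(w.1 α₁) + (2 : ℤ) • -(w.1 α₂)
        = -((3 : ℤ) • w.1 α₁ + (2 : ℤ) • w.1 α₂) := by
        simp only [smul_neg]; abel
      rw [this]; exact h3)
    apply Subtype.ext
    apply LinearEquiv.ext
    rintro ⟨a, b⟩
    rw [e, neg_eq_iff_eq_neg.mp hk.1, neg_eq_iff_eq_neg.mp hk.2]
    ext <;> simp [longest, α₁, α₂]

/-- The first fundamental weight. -/
def ϖ₁ : G2Weight := (2, 1)

/-- The second fundamental weight. -/
def ϖ₂ : G2Weight := (3, 2)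

/-- The fundamental weights are dual to the simple coroots. -/
theorem coroot_ϖ : coroot₁ ϖ₁ = 1 ∧ coroot₂ ϖ₁ = 0 ∧ coroot₁ ϖ₂ = 0 ∧ coroot₂ ϖ₂ = 1 := by
  simp [coroot₁_apply, coroot₂_apply, ϖ₁, ϖ₂]

/-- The half-sum of the positive roots. -/
def ρ : G2Weight := (5, 3)

theorem two_nsmul_ρ : 2 • ρ = ∑ v ∈ posRoots, v := by decide

/-- A weight is dominant if it pairs nonnegatively with the simple coroots. -/
def IsDominant (θ : G2Weight) : Prop := 0 ≤ coroot₁ θ ∧ 0 ≤ coroot₂ θ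

/-- The monomial `𝐱^(m₁ α₁ + m₂ α₂) = x ^ m₁ * y ^ m₂`. -/
def monom {K : Type*} [Field K] (x y : K) (v : G2Weight) : K := x ^ v.1 * y ^ v.2

/-- `D(𝐱) = ∏_{α > 0} (1 - 𝐱^α / q)`. -/
def D {K : Type*} [Field K] (q x y : K) : K := ∏ v ∈ posRoots, (1 - monom x y v / q)

/-- The quotient `∑_{w ∈ W} sgn(w) 𝐱^{w μ} / ∏_{α > 0} (1 - 𝐱^α)` of the character formula. -/
noncomputable def weylQuotient {K : Type*} [Field K] (x y : K) (μ : G2Weight) : K :=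
  (∑ w : weylGroup, (sgn w : K) * monom x y (w.1 μ)) / ∏ v ∈ posRoots, (1 - monom x y v)

/-! ### Littelmann patterns -/

/-- A 6-tuple `(a, b, c, d, e, f)` of nonnegative integers. -/
@[ext] structure Pattern where
  a : ℕ
  b : ℕ
  c : ℕ
  d : ℕ
  e : ℕ
  f : ℕ

/-- The names of the six entries. -/
inductive Entry where
  | a | b | c | d | e | f

namespace Pattern

/-- The value of an entry. -/
def val (π : Pattern) : Entry → ℚ
  | .a => π.a
  | .b => π.b
  | .c => π.c
  | .d => π.d
  | .e => π.e
  | .f => π.f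

/-- The lower bounds in the Littelmann inequalities. -/
def lower (π : Pattern) : Entry → ℚ
  | .a => π.b
  | .b => π.c / 2
  | .c => 2 * π.d
  | .d => π.e
  | .e => 0
  | .f => 0

/-- The upper bounds in the Littelmann inequalities. -/
def upper (ℓ₁ ℓ₂ : ℤ) (π : Pattern) : Entry → ℚ
  | .a => ℓ₁ + 3 * π.b - 2 * π.c + 3 * π.d - 2 * π.e
  | .b => ℓ₂ + π.c - 2 * π.d + π.e
  | .c => ℓ₁ + 3 * π.d - 2 * π.e
  | .d => ℓ₂ + π.e
  | .e => ℓ₁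
  | .f => ℓ₂ + π.a - 2 * π.b + π.c - 2 * π.d + π.e

/-- The Littelmann inequalities. -/
def IsLittelmann (ℓ₁ ℓ₂ : ℤ) (π : Pattern) : Prop :=
  ∀ u : Entry, π.lower u ≤ π.val u ∧ π.val u ≤ π.upper ℓ₁ ℓ₂ u

theorem finite_isLittelmann (ℓ₁ ℓ₂ : ℤ) : {π : Pattern | π.IsLittelmann ℓ₁ ℓ₂}.Finite := by
  let N : ℕ := 100 * (ℓ₁.toNat + ℓ₂.toNat)
  have hfin : ((fun p : (ℕ × ℕ × ℕ) × (ℕ × ℕ × ℕ) =>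
      (⟨p.1.1, p.1.2.1, p.1.2.2, p.2.1, p.2.2.1, p.2.2.2⟩ : Pattern)) ''
      Set.Iic ((N, N, N), (N, N, N))).Finite := (Set.finite_Iic _).image _
  refine hfin.subset ?_
  rintro ⟨a, b, c, d, e, f⟩ h
  refine ⟨((a, b, c), (d, e, f)), ?_, rfl⟩
  have ha := (h .a).2
  have hb := (h .b).2
  have hc := (h .c).2
  have hd := (h .d).2
  have he := (h .e).2
  have hf := (h .f).2
  simp only [val, upper] at ha hb hc hd he hf
  norm_cast at ha hb hc hd he hf
  simp only [Set.mem_Iic, Prod.mk_le_mk, N]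
  omega

/-- The finite set `𝓑` of Littelmann patterns for the weight `ℓ₁ ϖ₁ + ℓ₂ ϖ₂`. -/
noncomputable def littelmannPatterns (ℓ₁ ℓ₂ : ℤ) : Finset Pattern :=
  (finite_isLittelmann ℓ₁ ℓ₂).toFinset

/-- An entry is circled if it attains its lower bound. -/
def Circled (π : Pattern) (u : Entry) : Prop := π.val u = π.lower u

/-- An entry is boxed if it attains its upper bound. -/
def Boxed (ℓ₁ ℓ₂ : ℤ) (π : Pattern) (u : Entry) : Prop := π.val u = π.upper ℓ₁ ℓ₂ u

/-- An entry is plain if it is neither circled nor boxed. -/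
def Plain (ℓ₁ ℓ₂ : ℤ) (π : Pattern) (u : Entry) : Prop := ¬ π.Circled u ∧ ¬ π.Boxed ℓ₁ ℓ₂ u

open Classical in
/-- The factor `h(u)` of an entry `u`. -/
noncomputable def h {K : Type*} [Field K] (q : K) (ℓ₁ ℓ₂ : ℤ) (π : Pattern) (u : Entry) : K :=
  if π.Circled u ∧ π.Boxed ℓ₁ ℓ₂ u then 0
  else if π.Circled u then 1
  else if π.Boxed ℓ₁ ℓ₂ u then -1 / q
  else 1 - 1 / q

/-- The standard contribution. -/
noncomputable def Hstd {K : Type*} [Field K] (q : K) (ℓ₁ ℓ₂ : ℤ) (π : Pattern) : K :=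
  π.h q ℓ₁ ℓ₂ .a * π.h q ℓ₁ ℓ₂ .b * π.h q ℓ₁ ℓ₂ .c *
    π.h q ℓ₁ ℓ₂ .d * π.h q ℓ₁ ℓ₂ .e * π.h q ℓ₁ ℓ₂ .f

/-- Bad middle: `b = d + 1` and `c = 2 d + 1`. -/
def BadMiddle (π : Pattern) : Prop := π.b = π.d + 1 ∧ π.c = 2 * π.d + 1

/-- The condition `a = 2 d + 1 - e`. -/
def Special (π : Pattern) : Prop := (π.a : ℤ) = 2 * π.d + 1 - π.e

open Classical in
/-- The factor of the adjusted contribution that depends on `π' = (a, b, c, d, e)` only. It is zero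
without a bad middle, and in every case that is not listed. -/
noncomputable def Hadj' {K : Type*} [Field K] (q : K) (ℓ₁ ℓ₂ : ℤ) (π : Pattern) : K :=
  let C := π.Circled
  let B := π.Boxed ℓ₁ ℓ₂
  let P := π.Plain ℓ₁ ℓ₂
  let S := π.Special
  if ¬ π.BadMiddle then 0
  else if C .e ∧ C .d ∧ C .a then (1 - 1 / q) / q
  else if C .e ∧ (P .d ∨ C .d) ∧ B .a then -(1 - 1 / q) / q ^ 2
  else if (P .e ∨ C .e) ∧ B .d ∧ S then (1 - 1 / q) / q ^ 3
  else if (P .e ∧ C .d ∧ C .a) ∨ (C .e ∧ C .d ∧ P .a) ∨ (C .e ∧ P .d ∧ C .a) ∨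
      (P .e ∧ C .d ∧ P .a) ∨ (P .e ∧ P .d ∧ C .a) then (1 - 1 / q) ^ 2 / q
  else if (P .e ∨ C .e) ∧ B .d ∧ P .a ∧ ¬ S then -(1 - 1 / q) ^ 2 / q ^ 2
  else if P .e ∧ P .d ∧ P .a then (1 - 1 / q) ^ 3 / q
  else if C .e ∧ P .d ∧ P .a ∧ ¬ S then (1 - 1 / q) ^ 3 / q
  else if C .e ∧ P .d ∧ S then (1 - 1 / q) / q * ((1 - 1 / q) ^ 2 + 1 / q)
  else 0

/-- The adjusted contribution. -/
noncomputable def Hadj {K : Type*} [Field K] (q : K) (ℓ₁ ℓ₂ : ℤ) (π : Pattern) : K :=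
  π.Hadj' q ℓ₁ ℓ₂ * π.h q ℓ₁ ℓ₂ .f

/-- The coefficient `Ĥ(π) = H_std(π) + H_adj(π)`. -/
noncomputable def Hhat {K : Type*} [Field K] (q : K) (ℓ₁ ℓ₂ : ℤ) (π : Pattern) : K :=
  π.Hstd q ℓ₁ ℓ₂ + π.Hadj q ℓ₁ ℓ₂

end Pattern

end G2

/-! Put t = 1/q and let p, q from now on stand for ℓ₁, ℓ₂ (the field element q survives only as t,
up to the final assembly). Measured from lower bounds, the entries of a pattern run over iterated
intervals (`Pattern.sum_littelmannPatterns`), and the weights h are made for geometric series: with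
the end 0 circled and the end N boxed, the weighted sum of z^u is (1 - tz)/(1 - z) · (1 - z^N)
(`one_sub_mul_decorSum_pow`). Each summation therefore leaves only end terms, which are monomials in
the outer variables, and the standard contributions can be summed in closed form.

The obstruction is the bound c/2 ≤ b, which can be attained only for even c. The sum over b then
depends on the parity of c. After summation over c the parity of the range disappears (`midSum_eq`),
but numerators such as (1 - txy)(1 - tx³y) + (1-t)²x²y remain instead of products, and the sums over
d and e bring in the denominator 1 - x⁴y², which belongs to no root. The adjusted contributions live
on b = d + 1, c = 2d + 1; `adjPart_eq` and `adjSum_eq` sum them, with the same denominator 1 - x⁴y².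
In `stdSum_add_adjSum` the two defects cancel, and each of the twelve Weyl monomials receives the
coefficient ±∏(1 - t𝐱^α)/(1 - 𝐱^α).

This computation divides by 1 + x²y, which the hypotheses on roots do not control. Hence the
identity, cleared of denominators, is proved for indeterminates over ℤ and then specialised
(`stdSum_add_adjPart_mul`). On the other side, W is dihedral of order 12, and as -w_ℓ = 1 the
prefactor is 𝐱^(θ+ρ), which makes all exponents non-negative (`monom_mul_sum_sgn`). -/

namespace G2

/-! ### Decorated geometric series -/

/-- The factor of an entry in terms of its decorations: `C` for circled, `B` for boxed. -/
def decor {R : Type*} [CommRing R] (t : R) (C B : Prop) [Decidable C] [Decidable B] : R :=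
  if C ∧ B then 0 else if C then 1 else if B then -t else 1 - t

/-- The factor of an entry `u` that ranges over `[0, N]`. -/
def endWeight {R : Type*} [CommRing R] (t : R) (N u : ℕ) : R := decor t (u = 0) (u = N)

/-- The sum of `g` over `[0, N]`, weighted by decorations. -/
def decorSum {R : Type*} [CommRing R] (t : R) (N : ℕ) (g : ℕ → R) : R :=
  ∑ u ∈ Finset.range (N + 1), endWeight t N u * g u

section Ring

variable {R : Type*} [CommRing R] (t : R)

theorem decorSum_congr {N : ℕ} {g g' : ℕ → R} (h : ∀ u ≤ N, g u = g' u) :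
    decorSum t N g = decorSum t N g' :=
  Finset.sum_congr rfl fun u hu => by rw [h u (by simpa [Nat.lt_succ_iff] using hu)]

theorem decorSum_add (N : ℕ) (g g' : ℕ → R) :
    decorSum t N (fun u => g u + g' u) = decorSum t N g + decorSum t N g' := by
  simp [decorSum, mul_add, Finset.sum_add_distrib]

theorem decorSum_sub (N : ℕ) (g g' : ℕ → R) :
    decorSum t N (fun u => g u - g' u) = decorSum t N g - decorSum t N g' := by
  simp [decorSum, mul_sub, Finset.sum_sub_distrib]

theorem decorSum_const_mul (N : ℕ) (c : R) (g : ℕ → R) :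
    decorSum t N (fun u => c * g u) = c * decorSum t N g := by
  simp [decorSum, Finset.mul_sum, mul_left_comm]

/-- A single admissible value is both circled and boxed, so it has weight 0. This keeps the closed
forms valid for N = 0. -/
theorem decorSum_zero (g : ℕ → R) : decorSum t 0 g = 0 := by
  simp [decorSum, endWeight, decor]

theorem decorSum_succ (N : ℕ) (g : ℕ → R) :
    decorSum t (N + 1) g =
      g 0 + (1 - t) * ∑ u ∈ Finset.range N, g (u + 1) - t * g (N + 1) := by
  rw [decorSum, Finset.sum_range_succ, Finset.sum_range_succ', Finset.mul_sum]
  have : ∀ u ∈ Finset.range N, endWeight t (N + 1) (u + 1) * g (u + 1) = (1 - t) * g (u + 1) := by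
    intro u hu
    have : u ≠ N := (Finset.mem_range.1 hu).ne
    simp [endWeight, decor, this]
  rw [Finset.sum_congr rfl this]
  simp [endWeight, decor]
  ring

/-- Multiplication by 1 - z takes differences of consecutive weights. The constant interior weights
cancel, and what the two ends leave is 1 - tz and -z^N(1 - tz). -/
theorem one_sub_mul_decorSum_pow (z : R) (N : ℕ) :
    (1 - z) * decorSum t N (fun u => z ^ u) = (1 - t * z) * (1 - z ^ N) := by
  cases N with
  | zero => simp [decorSum_zero]
  | succ N =>
    rw [decorSum_succ]
    have h := mul_neg_geom_sum z N
    simp only [pow_succ, ← Finset.sum_mul]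
    linear_combination (1 - t) * z * h

/-- The sum over `b ∈ [c / 2, N]` of decorated powers. -/
theorem one_sub_mul_sum_half (z : R) (c N : ℕ) (h : c ≤ 2 * N) :
    (1 - z) * ∑ b ∈ Finset.Icc ((c + 1) / 2) N, decor t (2 * b = c) (b = N) * z ^ b =
      (if Even c then (1 - t * z) * z ^ (c / 2) else (1 - t) * z ^ ((c + 1) / 2)) -
        (1 - t * z) * z ^ N := by
  obtain ⟨k, rfl | rfl⟩ := Nat.even_or_odd' c
  · obtain ⟨j, rfl⟩ : ∃ j, N = k + j := ⟨N - k, by omega⟩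
    have e : (2 * k + 1) / 2 = k := by omega
    have e' : 2 * k / 2 = k := by omega
    rw [e, e', if_pos (even_two_mul k)]
    have : ∑ b ∈ Finset.Icc k (k + j), decor t (2 * b = 2 * k) (b = k + j) * z ^ b =
        z ^ k * decorSum t j (fun u => z ^ u) := by
      rw [decorSum, Finset.mul_sum, ← Finset.Ico_succ_right_eq_Icc, Finset.sum_Ico_eq_sum_range]
      apply Finset.sum_congr (by simp; congr 1; omega)
      intro u _
      simp [endWeight, pow_add, mul_left_comm]
    rw [this, mul_left_comm, one_sub_mul_decorSum_pow]
    ring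
  -- For odd c no b is circled, so every b below N has weight 1 - t.
  · obtain ⟨j, rfl⟩ : ∃ j, N = k + 1 + j := ⟨N - (k + 1), by omega⟩
    have e : (2 * k + 1 + 1) / 2 = k + 1 := by omega
    rw [e, if_neg (by simp)]
    have : ∑ b ∈ Finset.Icc (k + 1) (k + 1 + j), decor t (2 * b = 2 * k + 1) (b = k + 1 + j) * z ^ b
        = (1 - t) * z ^ (k + 1) * (∑ u ∈ Finset.range j, z ^ u) - t * z ^ (k + 1 + j) := by
      rw [← Finset.Ico_succ_right_eq_Icc, Finset.sum_Ico_eq_sum_range]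
      have : Order.succ (k + 1 + j) - (k + 1) = j + 1 := by simp; omega
      rw [this, Finset.sum_range_succ, Finset.mul_sum, sub_eq_add_neg]
      congr 1
      · refine Finset.sum_congr rfl fun u hu => ?_
        have h1 : u ≠ j := (Finset.mem_range.1 hu).ne
        have h2 : 2 * (k + 1 + u) ≠ 2 * k + 1 := by omega
        simp [decor, h1, h2, pow_add]
        ring
      · have h2 : 2 * (k + 1 + j) ≠ 2 * k + 1 := by omega
        simp [decor, h2]
    rw [this]
    have h := mul_neg_geom_sum z j
    linear_combination (1 - t) * z ^ (k + 1) * h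

/-- The values of the sum over `b` at its lower end. -/
def halfPow (t z : R) (c : ℕ) : R :=
  if Even c then (1 - t * z) * z ^ (c / 2) else (1 - t) * z ^ ((c + 1) / 2)

theorem halfPow_even (z : R) (k : ℕ) : halfPow t z (2 * k) = (1 - t * z) * z ^ k := by
  simp [halfPow]

theorem halfPow_odd (z : R) (k : ℕ) : halfPow t z (2 * k + 1) = (1 - t) * z ^ (k + 1) := by
  have : (2 * k + 1 + 1) / 2 = k + 1 := by omega
  simp [halfPow, this]

theorem sum_range_two_mul (g : ℕ → R) (k : ℕ) :
    ∑ u ∈ Finset.range (2 * k), g u = ∑ u ∈ Finset.range k, (g (2 * u) + g (2 * u + 1)) := by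
  induction k with
  | zero => simp
  | succ k ih => rw [Nat.mul_succ, Finset.sum_range_succ, Finset.sum_range_succ, ih,
      Finset.sum_range_succ, add_assoc]

/-- The terms c = 2u + 1 and c = 2u + 2 form a block that is multiplied by w²z when u grows by one,
so the interior is a geometric series in blocks. -/
theorem mul_decorSum_halfPow_even (w z : R) (k : ℕ) :
    (1 - w ^ 2 * z) * decorSum t (2 * k) (fun c => w ^ c * halfPow t z c) =
      ((1 - t * z) * (1 - t * w ^ 2 * z) + (1 - t) ^ 2 * w * z) * (1 - (w ^ 2 * z) ^ k) := by
  cases k with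
  | zero => simp [decorSum_zero]
  | succ k =>
    have e : 2 * (k + 1) = 2 * k + 1 + 1 := by ring
    rw [e, decorSum_succ, Finset.sum_range_succ, ← e, halfPow_even,
      sum_range_two_mul (fun u => w ^ (u + 1) * halfPow t z (u + 1))]
    have : ∀ u ∈ Finset.range k, w ^ (2 * u + 1) * halfPow t z (2 * u + 1) +
        w ^ (2 * u + 1 + 1) * halfPow t z (2 * u + 1 + 1) =
        (w * (1 - t) * z + w ^ 2 * z * (1 - t * z)) * (w ^ 2 * z) ^ u := by
      intro u _
      rw [halfPow_odd, show 2 * u + 1 + 1 = 2 * (u + 1) by ring, halfPow_even]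
      ring
    rw [Finset.sum_congr rfl this, ← Finset.mul_sum, halfPow_odd]
    have h0 : halfPow t z 0 = 1 - t * z := by simpa using halfPow_even t z 0
    rw [h0]
    have h := mul_neg_geom_sum (w ^ 2 * z) k
    linear_combination (1 - t) * (w * (1 - t) * z + w ^ 2 * z * (1 - t * z)) * h

/-- Now the boxed end is odd and falls into the other branch of `halfPow`, so the end term has a
different shape from the even case. -/
theorem mul_decorSum_halfPow_odd (w z : R) (k : ℕ) :
    (1 - w ^ 2 * z) * decorSum t (2 * k + 1) (fun c => w ^ c * halfPow t z c) =
      (1 - t * z) * (1 - t * w ^ 2 * z) + (1 - t) ^ 2 * w * z -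
        w * z * (w ^ 2 * z) ^ k * (1 - t) * ((1 - t * z) * w + 1 - t * w ^ 2 * z) := by
  rw [decorSum_succ, sum_range_two_mul (fun u => w ^ (u + 1) * halfPow t z (u + 1))]
  have : ∀ u ∈ Finset.range k, w ^ (2 * u + 1) * halfPow t z (2 * u + 1) +
      w ^ (2 * u + 1 + 1) * halfPow t z (2 * u + 1 + 1) =
      (w * (1 - t) * z + w ^ 2 * z * (1 - t * z)) * (w ^ 2 * z) ^ u := by
    intro u _
    rw [halfPow_odd, show 2 * u + 1 + 1 = 2 * (u + 1) by ring, halfPow_even]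
    ring
  rw [Finset.sum_congr rfl this, ← Finset.mul_sum, halfPow_odd]
  have h0 : halfPow t z 0 = 1 - t * z := by simpa using halfPow_even t z 0
  rw [h0]
  have h := mul_neg_geom_sum (w ^ 2 * z) k
  linear_combination (1 - t) * (w * (1 - t) * z + w ^ 2 * z * (1 - t * z)) * h

end Ring

end G2

/-! ### The sum over a, b, c, f for fixed d and e -/

namespace G2

/-- The value of a decorated geometric series, up to the difference of its end terms. -/
def ratio {K : Type*} [Field K] (t z : K) : K := (1 - t * z) / (1 - z)

/-- The decorated sum over the entries `a, b, c, f` of a pattern whose entries `d` and `e` have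
slack `m = ℓ₁ + d - 2 e` and `n = ℓ₂ + e - d`. -/
def midSum {R : Type*} [CommRing R] (t x y : R) (m n : ℕ) : R :=
  decorSum t m fun c => x ^ c * ∑ b ∈ Finset.Icc ((c + 1) / 2) (n + c),
    decor t (2 * b = c) (b = n + c) * ((x * y) ^ b *
      decorSum t (m + 2 * b - 2 * c) fun a => x ^ a * decorSum t (n + c + a - b) fun f => y ^ f)

section Field

variable {K : Type*} [Field K] {t : K}

theorem decorSum_pow {z : K} (hz : 1 - z ≠ 0) (N : ℕ) :
    decorSum t N (fun u => z ^ u) = ratio t z * (1 - z ^ N) := by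
  rw [ratio, div_mul_eq_mul_div, eq_div_iff hz, mul_comm, one_sub_mul_decorSum_pow]

theorem sum_half {z : K} (hz : 1 - z ≠ 0) (c N : ℕ) (h : c ≤ 2 * N) :
    ∑ b ∈ Finset.Icc ((c + 1) / 2) N, decor t (2 * b = c) (b = N) * z ^ b =
      (1 - z)⁻¹ * halfPow t z c - ratio t z * z ^ N := by
  have := one_sub_mul_sum_half t z c N h
  rw [← halfPow] at this
  rw [ratio]
  field_simp
  linear_combination this

/-- The sums over f and a each leave two end terms, which gives four geometric terms in b. The
bounds on b and c ensure that no subtraction in ℕ is truncated. -/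
theorem decorSum_af {x y : K} (hx : x ≠ 0) (hy : y ≠ 0) (h1 : 1 - x ≠ 0) (h2 : 1 - y ≠ 0)
    (h3 : 1 - x * y ≠ 0) {m n c b : ℕ} (hc : c ≤ m) (hcb : c ≤ 2 * b) (hb : b ≤ n + c) :
    (x * y) ^ b *
      decorSum t (m + 2 * b - 2 * c) (fun a => x ^ a * decorSum t (n + c + a - b) fun f => y ^ f) =
    ratio t y * ratio t x * (x * y) ^ b
      - ratio t y * ratio t x * x ^ m * ((x ^ c)⁻¹) ^ 2 * (x ^ 3 * y) ^ b
      - ratio t y * ratio t (x * y) * y ^ n * y ^ c * x ^ b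
      + ratio t y * ratio t (x * y) * y ^ n * y ^ c * (x * y) ^ m * (((x * y) ^ c)⁻¹) ^ 2 *
        (x ^ 3 * y ^ 2) ^ b := by
  have key : ∀ a, x ^ a * decorSum t (n + c + a - b) (fun f => y ^ f) =
      ratio t y * x ^ a - ratio t y * (y ^ n * y ^ c * (y ^ b)⁻¹) * (x * y) ^ a := by
    intro a
    rw [decorSum_pow h2, show n + c + a - b = (n + c - b) + a by omega, pow_add,
      pow_sub₀ y hy hb]
    ring
  have hM : ∀ z : K, z ≠ 0 → z ^ (m + 2 * b - 2 * c) = z ^ m * (z ^ b) ^ 2 * ((z ^ c)⁻¹) ^ 2 := by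
    intro z hz
    rw [pow_sub₀ z hz (by omega)]
    ring
  simp only [key]
  rw [decorSum_sub, decorSum_const_mul, decorSum_const_mul, decorSum_pow h1, decorSum_pow h3,
    hM x hx, hM (x * y) (mul_ne_zero hx hy)]
  have : y ^ b ≠ 0 := pow_ne_zero _ hy
  field_simp
  ring

theorem decorSum_halfPow_even {w z : K} (h : 1 - w ^ 2 * z ≠ 0) (k : ℕ) :
    decorSum t (2 * k) (fun c => w ^ c * halfPow t z c) =
      ((1 - t * z) * (1 - t * w ^ 2 * z) + (1 - t) ^ 2 * w * z) * (1 - (w ^ 2 * z) ^ k)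
        / (1 - w ^ 2 * z) := by
  rw [eq_div_iff h, mul_comm, mul_decorSum_halfPow_even]

theorem decorSum_halfPow_odd {w z : K} (h : 1 - w ^ 2 * z ≠ 0) (k : ℕ) :
    decorSum t (2 * k + 1) (fun c => w ^ c * halfPow t z c) =
      ((1 - t * z) * (1 - t * w ^ 2 * z) + (1 - t) ^ 2 * w * z -
        w * z * (w ^ 2 * z) ^ k * (1 - t) * ((1 - t * z) * w + 1 - t * w ^ 2 * z))
        / (1 - w ^ 2 * z) := by
  rw [eq_div_iff h, mul_comm, mul_decorSum_halfPow_odd]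

/-- Each of the four geometric series in b has a lower end, which gives a `halfPow` sum over c, and
an upper end b = n + c. All four upper ends turn out to be multiples of (x²y)^c. -/
theorem midSum_eq_decorSum {x y : K} (hx : x ≠ 0) (hy : y ≠ 0) (h1 : 1 - x ≠ 0) (h2 : 1 - y ≠ 0)
    (h3 : 1 - x * y ≠ 0) (h4 : 1 - x ^ 3 * y ≠ 0) (h5 : 1 - x ^ 3 * y ^ 2 ≠ 0)
    (h6 : 1 - x ^ 2 * y ≠ 0) (m n : ℕ) :
    midSum t x y m n =
      ratio t y * ratio t x * (1 - x * y)⁻¹ * decorSum t m (fun c => x ^ c * halfPow t (x * y) c)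
      - ratio t y * ratio t x * x ^ m * (1 - x ^ 3 * y)⁻¹ *
        decorSum t m (fun c => x⁻¹ ^ c * halfPow t (x ^ 3 * y) c)
      - ratio t y * ratio t (x * y) * y ^ n * (1 - x)⁻¹ *
        decorSum t m (fun c => (x * y) ^ c * halfPow t x c)
      + ratio t y * ratio t (x * y) * y ^ n * (x * y) ^ m * (1 - x ^ 3 * y ^ 2)⁻¹ *
        decorSum t m (fun c => (x * y)⁻¹ ^ c * halfPow t (x ^ 3 * y ^ 2) c)
      + ratio t y * ratio t (x ^ 2 * y) *
        (ratio t x * ratio t (x ^ 3 * y) * x ^ m * (x ^ 3 * y) ^ n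
          - ratio t (x * y) * ratio t (x ^ 3 * y ^ 2) * y ^ n * (x * y) ^ m * (x ^ 3 * y ^ 2) ^ n)
        * (1 - (x ^ 2 * y) ^ m) := by
  -- The last summand is zero: the upper ends of the first and the third series cancel.
  have key : ∀ c ≤ m, x ^ c * ∑ b ∈ Finset.Icc ((c + 1) / 2) (n + c),
      decor t (2 * b = c) (b = n + c) * ((x * y) ^ b *
        decorSum t (m + 2 * b - 2 * c) fun a => x ^ a * decorSum t (n + c + a - b) fun f => y ^ f) =
      ratio t y * ratio t x * (1 - x * y)⁻¹ * (x ^ c * halfPow t (x * y) c)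
      - ratio t y * ratio t x * x ^ m * (1 - x ^ 3 * y)⁻¹ * (x⁻¹ ^ c * halfPow t (x ^ 3 * y) c)
      - ratio t y * ratio t (x * y) * y ^ n * (1 - x)⁻¹ * ((x * y) ^ c * halfPow t x c)
      + ratio t y * ratio t (x * y) * y ^ n * (x * y) ^ m * (1 - x ^ 3 * y ^ 2)⁻¹ *
        ((x * y)⁻¹ ^ c * halfPow t (x ^ 3 * y ^ 2) c)
      + ratio t y *
        (ratio t x * ratio t (x ^ 3 * y) * x ^ m * (x ^ 3 * y) ^ n
          - ratio t (x * y) * ratio t (x ^ 3 * y ^ 2) * y ^ n * (x * y) ^ m * (x ^ 3 * y ^ 2) ^ n)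
        * (x ^ 2 * y) ^ c
      + (-ratio t y * ratio t x * ratio t (x * y) * (x * y) ^ n
        + ratio t y * ratio t (x * y) * ratio t x * y ^ n * x ^ n) * (x ^ 2 * y) ^ c := by
    intro c hc
    rw [Finset.sum_congr rfl fun b hb => congrArg (decor t (2 * b = c) (b = n + c) * ·)
      (decorSum_af (t := t) hx hy h1 h2 h3 hc (by have := Finset.mem_Icc.1 hb; omega)
        (Finset.mem_Icc.1 hb).2)]
    simp only [mul_add, mul_sub, Finset.sum_add_distrib, Finset.sum_sub_distrib]
    have pull : ∀ k z : K, ∑ b ∈ Finset.Icc ((c + 1) / 2) (n + c),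
        decor t (2 * b = c) (b = n + c) * (k * z ^ b) =
        k * (∑ b ∈ Finset.Icc ((c + 1) / 2) (n + c), decor t (2 * b = c) (b = n + c) * z ^ b) := by
      intro k z
      rw [Finset.mul_sum]
      exact Finset.sum_congr rfl fun b _ => by ring
    simp only [pull]
    rw [sum_half h3 _ _ (by omega), sum_half h4 _ _ (by omega), sum_half h1 _ _ (by omega),
      sum_half h5 _ _ (by omega)]
    have e1 : x ^ c ≠ 0 := pow_ne_zero _ hx
    have e2 : y ^ c ≠ 0 := pow_ne_zero _ hy
    simp only [mul_pow, pow_add, inv_pow, mul_inv]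
    generalize ratio t y = r1
    generalize ratio t x = r2
    generalize ratio t (x * y) = r3
    generalize ratio t (x ^ 3 * y) = r4
    generalize ratio t (x ^ 3 * y ^ 2) = r5
    generalize (1 - x * y)⁻¹ = i1
    generalize (1 - x)⁻¹ = i2
    generalize (1 - x ^ 3 * y)⁻¹ = i3
    generalize (1 - x ^ 3 * y ^ 2)⁻¹ = i4
    generalize halfPow t x c = j1
    generalize halfPow t (x * y) c = j2
    generalize halfPow t (x ^ 3 * y) c = j3
    generalize halfPow t (x ^ 3 * y ^ 2) c = j4
    field_simp
    ring
  rw [midSum, decorSum_congr t key]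
  simp only [decorSum_add, decorSum_sub, decorSum_const_mul]
  rw [decorSum_pow h6, mul_pow]
  ring

/-- The closed form of `midSum`. -/
theorem midSum_eq {x y : K} (hx : x ≠ 0) (hy : y ≠ 0) (h1 : 1 - x ≠ 0) (h2 : 1 - y ≠ 0)
    (h3 : 1 - x * y ≠ 0) (h4 : 1 - x ^ 3 * y ≠ 0) (h5 : 1 - x ^ 3 * y ^ 2 ≠ 0)
    (h6 : 1 - x ^ 2 * y ≠ 0) (m n : ℕ) :
    midSum t x y m n =
      ratio t y * ratio t x * (1 - x * y * t + x ^ 2 * y * (1 - t) ^ 2 - x ^ 3 * y * t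
        + x ^ 4 * y ^ 2 * t ^ 2) / ((1 - x * y) * (1 - x ^ 3 * y)) * (1 - x ^ m)
      - ratio t y * ratio t (x * y) * (1 - x * t + x ^ 2 * y * (1 - t) ^ 2 - x ^ 3 * y ^ 2 * t
        + x ^ 4 * y ^ 2 * t ^ 2) / ((1 - x) * (1 - x ^ 3 * y ^ 2)) * y ^ n * (1 - (x * y) ^ m)
      + ratio t y * ratio t x * ratio t (x ^ 2 * y) * ratio t (x ^ 3 * y) *
        x ^ m * (x ^ 3 * y) ^ n * (1 - (x ^ 2 * y) ^ m)
      - ratio t y * ratio t (x * y) * ratio t (x ^ 2 * y) * ratio t (x ^ 3 * y ^ 2) *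
        (x * y) ^ m * (x ^ 3 * y ^ 3) ^ n * (1 - (x ^ 2 * y) ^ m) := by
  have w1 : x ^ 2 * (x * y) = x ^ 3 * y := by ring
  have w2 : x⁻¹ ^ 2 * (x ^ 3 * y) = x * y := by field_simp
  have w3 : (x * y) ^ 2 * x = x ^ 3 * y ^ 2 := by ring
  have w4 : (x * y)⁻¹ ^ 2 * (x ^ 3 * y ^ 2) = x := by field_simp
  rw [midSum_eq_decorSum hx hy h1 h2 h3 h4 h5 h6]
  have c0 : y ^ n * (x ^ 3 * y ^ 2) ^ n = (x ^ 3 * y ^ 3) ^ n := by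
    rw [← mul_pow]; ring
  -- Replacing (w, z) by (1/w, w²z) exchanges z and w²z and keeps wz. The two `halfPow` sums thus
  -- share numerator and denominator for even m, and in either parity their parity-dependent end
  -- terms cancel down to 1 - x^m. The same happens in `main'`.
  have main : ratio t x * (1 - x * y)⁻¹ * decorSum t m (fun c => x ^ c * halfPow t (x * y) c)
      - ratio t x * x ^ m * (1 - x ^ 3 * y)⁻¹ *
        decorSum t m (fun c => x⁻¹ ^ c * halfPow t (x ^ 3 * y) c) =
      ratio t x * (1 - x * y * t + x ^ 2 * y * (1 - t) ^ 2 - x ^ 3 * y * t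
        + x ^ 4 * y ^ 2 * t ^ 2) / ((1 - x * y) * (1 - x ^ 3 * y)) * (1 - x ^ m) := by
    obtain ⟨k, rfl | rfl⟩ := Nat.even_or_odd' m
    · rw [decorSum_halfPow_even (by rwa [w1]), decorSum_halfPow_even (by rwa [w2])]
      simp only [mul_assoc t, w1, w2]
      generalize ratio t x = r
      field_simp
      ring
    · rw [decorSum_halfPow_odd (by rwa [w1]), decorSum_halfPow_odd (by rwa [w2])]
      simp only [mul_assoc t, w1, w2]
      generalize ratio t x = r
      field_simp
      ring
  have main' : ratio t (x * y) * (1 - x)⁻¹ * decorSum t m (fun c => (x * y) ^ c * halfPow t x c)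
      - ratio t (x * y) * (x * y) ^ m * (1 - x ^ 3 * y ^ 2)⁻¹ *
        decorSum t m (fun c => (x * y)⁻¹ ^ c * halfPow t (x ^ 3 * y ^ 2) c) =
      ratio t (x * y) * (1 - x * t + x ^ 2 * y * (1 - t) ^ 2 - x ^ 3 * y ^ 2 * t
        + x ^ 4 * y ^ 2 * t ^ 2) / ((1 - x) * (1 - x ^ 3 * y ^ 2)) * (1 - (x * y) ^ m) := by
    obtain ⟨k, rfl | rfl⟩ := Nat.even_or_odd' m
    · rw [decorSum_halfPow_even (by rwa [w3]), decorSum_halfPow_even (by rwa [w4])]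
      simp only [mul_assoc t, w3, w4]
      generalize ratio t (x * y) = r
      field_simp
      ring
    · rw [decorSum_halfPow_odd (by rwa [w3]), decorSum_halfPow_odd (by rwa [w4])]
      simp only [mul_assoc t, w3, w4]
      generalize ratio t (x * y) = r
      field_simp
      ring
  rw [← c0]
  linear_combination ratio t y * main - ratio t y * y ^ n * main'

end Field

end G2

/-! ### The sum of the adjusted factors -/

namespace G2

open Classical in
/-- The adjusted factor in terms of the decorations of `e`, `d`, `a` (`C` circled, `B` boxed,
`P` plain) and of the condition `S` on `a`. -/
noncomputable def adjFactor {R : Type*} [CommRing R] (t : R)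
    (Ce Pe Cd Pd Bd Ca Pa Ba S : Prop) : R :=
  if Ce ∧ Cd ∧ Ca then (1 - t) * t
  else if Ce ∧ (Pd ∨ Cd) ∧ Ba then -((1 - t) * t ^ 2)
  else if (Pe ∨ Ce) ∧ Bd ∧ S then (1 - t) * t ^ 3
  else if (Pe ∧ Cd ∧ Ca) ∨ (Ce ∧ Cd ∧ Pa) ∨ (Ce ∧ Pd ∧ Ca) ∨ (Pe ∧ Cd ∧ Pa) ∨ (Pe ∧ Pd ∧ Ca) then
    (1 - t) ^ 2 * t
  else if (Pe ∨ Ce) ∧ Bd ∧ Pa ∧ ¬ S then -((1 - t) ^ 2 * t ^ 2)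
  else if Pe ∧ Pd ∧ Pa then (1 - t) ^ 3 * t
  else if Ce ∧ Pd ∧ Pa ∧ ¬ S then (1 - t) ^ 3 * t
  else if Ce ∧ Pd ∧ S then (1 - t) * t * ((1 - t) ^ 2 + t)
  else 0

/-- The adjusted factor in slack coordinates. -/
noncomputable def adjWeight {R : Type*} [CommRing R] (t : R) (p q e d a : ℕ) : R :=
  adjFactor t (e = 0) (e ≠ 0 ∧ e ≠ p) (d = 0) (d ≠ 0 ∧ d ≠ q) (d = q) (a = 0)
    (a ≠ 0 ∧ a ≠ p - e + d) (a = p - e + d) (a = d)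

/-- The sum of the adjusted factors with weight `z ^ a * r ^ d * (z * r) ^ e`. -/
noncomputable def adjSum {R : Type*} [CommRing R] (t z r : R) (p q : ℕ) : R :=
  ∑ e ∈ Finset.range (p + 1), (z * r) ^ e * ∑ d ∈ Finset.range (q + 1), r ^ d *
    ∑ a ∈ Finset.range (p - e + d + 1), adjWeight t p q e d a * z ^ a

/-- For p > 0 the value e = p is boxed and not circled, and no listed case admits this. -/
theorem adjWeight_boxed {R : Type*} [CommRing R] (t : R) {p q d a : ℕ} (hp : 0 < p) :
    adjWeight t p q p d a = 0 := by
  simp [adjWeight, adjFactor, hp.ne']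

section Field

variable {K : Type*} [Field K] {t z : K}

theorem sum_range_pow_succ (hz : 1 - z ≠ 0) (N : ℕ) :
    ∑ i ∈ Finset.range N, z ^ (i + 1) = (z - z ^ (N + 1)) / (1 - z) := by
  rw [eq_div_iff hz]
  simp only [pow_succ, ← Finset.sum_mul]
  linear_combination z * mul_neg_geom_sum z N

theorem sum_range_of_ends (hz : 1 - z ≠ 0) {M : ℕ} (hM : 0 < M) {f : ℕ → K} {α β δ : K}
    (h0 : f 0 = α) (h : ∀ i, 0 < i → i < M → f i = β) (h1 : f M = δ) :
    ∑ a ∈ Finset.range (M + 1), f a * z ^ a = α + β * ((z - z ^ M) / (1 - z)) + δ * z ^ M := by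
  obtain ⟨N, rfl⟩ : ∃ N, M = N + 1 := ⟨M - 1, by omega⟩
  rw [Finset.sum_range_succ, Finset.sum_range_succ', h0, h1, ← sum_range_pow_succ hz,
    Finset.mul_sum, Finset.sum_congr rfl fun i hi => by
      rw [h (i + 1) (by omega) (by have := Finset.mem_range.1 hi; omega)]]
  ring

theorem sum_range_of_ends_of_special (hz : 1 - z ≠ 0) {M k : ℕ} (hk : 0 < k) (hkM : k < M)
    {f : ℕ → K} {α β γ δ : K} (h0 : f 0 = α) (h : ∀ i, 0 < i → i < M → i ≠ k → f i = β)
    (hs : f k = γ) (h1 : f M = δ) :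
    ∑ a ∈ Finset.range (M + 1), f a * z ^ a =
      α + β * ((z - z ^ M) / (1 - z)) + (γ - β) * z ^ k + δ * z ^ M := by
  have := sum_range_of_ends hz (hk.trans hkM) (f := fun i => if i = k then β else f i)
    (α := α) (β := β) (δ := δ) (by simp [hk.ne, h0]) (fun i h2 h3 => by
      by_cases hi : i = k
      · simp [hi]
      · simp [hi, h i h2 h3 hi]) (by simp [hkM.ne', h1])
  have e : ∑ a ∈ Finset.range (M + 1), f a * z ^ a =
      ∑ a ∈ Finset.range (M + 1), ((if a = k then β else f a) * z ^ a +
        if a = k then (γ - β) * z ^ k else 0) := by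
    refine Finset.sum_congr rfl fun a _ => ?_
    by_cases ha : a = k
    · subst ha; simp [hs]; ring
    · simp [ha]
  rw [e, Finset.sum_add_distrib, this, Finset.sum_ite_eq' _ k,
    if_pos (Finset.mem_range.2 (by omega))]
  ring

/-- Here d is boxed. Since e < p, the special value a = q lies strictly between the ends, and
neither end of a is a listed case. -/
theorem adjWeight_sum_last (hz : 1 - z ≠ 0) {p q e : ℕ} (he : e < p) (hq : 0 < q) :
    ∑ a ∈ Finset.range (p - e + q + 1), adjWeight t p q e q a * z ^ a =
      (1 - t) * t ^ 2 * (z ^ q - (1 - t) * ((z - z ^ (p - e + q)) / (1 - z))) := by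
  have hpe : p ≠ e := he.ne'
  rw [sum_range_of_ends_of_special hz (k := q) hq (by omega) (α := 0)
    (β := -((1 - t) ^ 2 * t ^ 2)) (γ := (1 - t) * t ^ 3) (δ := 0)]
  · ring
  · have : ¬ 0 = p - e + q := by omega
    have : ¬ 0 = q := by omega
    by_cases h : e = 0 <;> simp [adjWeight, adjFactor, *, hq.ne', he.ne]
  · intro i h1 h2 h3
    have : i ≠ p - e + q := by omega
    by_cases h : e = 0 <;> simp [adjWeight, adjFactor, *, hq.ne', he.ne, h1.ne']
    subst h
    simp_all
  · by_cases h : e = 0 <;> simp [adjWeight, adjFactor, *, hq.ne', he.ne]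
  · have : p - e ≠ 0 := by omega
    by_cases h : e = 0 <;> simp [adjWeight, adjFactor, *, hq.ne', he.ne]
    subst h
    simp_all

theorem adjWeight_sum_zero_zero (hz : 1 - z ≠ 0) {p q : ℕ} (hp : 0 < p) (hq : 0 < q) :
    ∑ a ∈ Finset.range (p + 0 + 1), adjWeight t p q 0 0 a * z ^ a =
      (1 - t) * t * (1 + (1 - t) * ((z - z ^ p) / (1 - z)) - t * z ^ p) := by
  rw [sum_range_of_ends hz (by omega) (α := (1 - t) * t) (β := (1 - t) ^ 2 * t)
    (δ := -((1 - t) * t ^ 2))]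
  · ring
  · simp [adjWeight, adjFactor]
  · intro i h1 h2
    have : i ≠ p := by omega
    simp [adjWeight, adjFactor, *, hq.ne, h1.ne']
  · simp [adjWeight, adjFactor, hp.ne', hq.ne]

/-- The special value a = d exceeds the generic weight (1-t)³t by (1-t)t², which explains the last
summand. -/
theorem adjWeight_sum_zero_mid (hz : 1 - z ≠ 0) {p q d : ℕ} (hp : 0 < p) (hd : 0 < d)
    (hdq : d < q) :
    ∑ a ∈ Finset.range (p + d + 1), adjWeight t p q 0 d a * z ^ a =
      (1 - t) ^ 2 * t - (1 - t) * t ^ 2 * z ^ (p + d)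
        + (1 - t) ^ 3 * t * ((z - z ^ (p + d)) / (1 - z)) + (1 - t) * t ^ 2 * z ^ d := by
  rw [sum_range_of_ends_of_special hz (k := d) hd (by omega) (α := (1 - t) ^ 2 * t)
    (β := (1 - t) ^ 3 * t) (γ := (1 - t) * t * ((1 - t) ^ 2 + t)) (δ := -((1 - t) * t ^ 2))]
  · ring
  · have h0 : ¬ 0 = p + d := by omega
    simp [adjWeight, adjFactor, hd.ne', hdq.ne, h0]
  · intro i h1 h2 h3
    have : i ≠ p + d := by omega
    simp [adjWeight, adjFactor, *, hd.ne', hdq.ne, h1.ne']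
  · simp [adjWeight, adjFactor, hd.ne', hdq.ne, hp.ne']
  · simp [adjWeight, adjFactor, hd.ne', hdq.ne]

theorem adjWeight_sum_plain_zero (hz : 1 - z ≠ 0) {p q e : ℕ} (he : 0 < e) (hep : e < p)
    (hq : 0 < q) :
    ∑ a ∈ Finset.range (p - e + 0 + 1), adjWeight t p q e 0 a * z ^ a =
      (1 - t) ^ 2 * t * (1 + (z - z ^ (p - e)) / (1 - z)) := by
  have h4 : p - e ≠ 0 := by omega
  rw [sum_range_of_ends hz (by omega) (α := (1 - t) ^ 2 * t) (β := (1 - t) ^ 2 * t) (δ := 0)]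
  · ring
  · simp [adjWeight, adjFactor, he.ne', hep.ne, hq.ne]
  · intro i h1 h2
    have : i ≠ p - e := by omega
    simp [adjWeight, adjFactor, *, he.ne', hep.ne, hq.ne, h1.ne']
  · simp [adjWeight, adjFactor, he.ne', hq.ne, h4]

theorem adjWeight_sum_plain_mid (hz : 1 - z ≠ 0) {p q e d : ℕ} (he : 0 < e) (hep : e < p)
    (hd : 0 < d) (hdq : d < q) :
    ∑ a ∈ Finset.range (p - e + d + 1), adjWeight t p q e d a * z ^ a =
      (1 - t) ^ 2 * t * (1 + (1 - t) * ((z - z ^ (p - e + d)) / (1 - z))) := by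
  rw [sum_range_of_ends hz (by omega) (α := (1 - t) ^ 2 * t) (β := (1 - t) ^ 3 * t) (δ := 0)]
  · ring
  · simp [adjWeight, adjFactor, he.ne', hep.ne, hd.ne', hdq.ne]
  · intro i h1 h2
    have : i ≠ p - e + d := by omega
    simp [adjWeight, adjFactor, *, he.ne', hep.ne, hd.ne', hdq.ne, h1.ne']
  · simp [adjWeight, adjFactor, he.ne', hd.ne', hdq.ne]

/-- The closed form of `adjSum`. -/
theorem adjSum_eq {r : K} (hz0 : z ≠ 0) (hz : 1 - z ≠ 0) (hr : 1 - r ≠ 0) (hzr : 1 - z * r ≠ 0)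
    {p q : ℕ} (hp : 0 < p) (hq : 0 < q) :
    adjSum t z r p q = (1 - t) * t * ((1 - t * z) * (1 - t * r) *
        (1 - z ^ p + z ^ p * (z * r) ^ q - (z * r) ^ p * (z * r) ^ q)
        - (1 - t) * (1 - t * (z * r)) * r ^ q * (1 - (z * r) ^ p))
      / ((1 - z) * (1 - r) * (1 - z * r)) := by
  obtain ⟨P, rfl⟩ : ∃ N, p = N + 1 := ⟨p - 1, by omega⟩
  obtain ⟨Q, rfl⟩ : ∃ N, q = N + 1 := ⟨q - 1, by omega⟩
  have split : ∀ g : ℕ → K, ∑ d ∈ Finset.range (Q + 1 + 1), r ^ d * g d =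
      g 0 + ∑ d ∈ Finset.range Q, r ^ (d + 1) * g (d + 1) + r ^ (Q + 1) * g (Q + 1) := by
    intro g
    rw [Finset.sum_range_succ, Finset.sum_range_succ']
    simp [add_comm]
  -- The interior row sums are affine in z^d, so weighting by r^d produces the two ratios r and zr.
  have lin : ∀ (g : ℕ → K) (α β : K), (∀ d < Q, g (d + 1) = α + β * z ^ (d + 1)) →
      ∑ d ∈ Finset.range Q, r ^ (d + 1) * g (d + 1) =
      α * ((r - r ^ (Q + 1)) / (1 - r))
        + β * ((z * r - (z * r) ^ (Q + 1)) / (1 - z * r)) := by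
    intro g α β h
    rw [← sum_range_pow_succ hr, ← sum_range_pow_succ hzr, Finset.mul_sum, Finset.mul_sum,
      ← Finset.sum_add_distrib]
    refine Finset.sum_congr rfl fun d hd => ?_
    rw [h d (Finset.mem_range.1 hd), mul_pow]
    ring
  have row0 : ∑ d ∈ Finset.range (Q + 1 + 1), r ^ d *
      ∑ a ∈ Finset.range (P + 1 - 0 + d + 1), adjWeight t (P + 1) (Q + 1) 0 d a * z ^ a =
      (1 - t) * t * (1 + (1 - t) * ((z - z ^ (P + 1)) / (1 - z)) - t * z ^ (P + 1))
      + (((1 - t) ^ 2 * t + (1 - t) ^ 3 * t * (z / (1 - z))) * ((r - r ^ (Q + 1)) / (1 - r))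
      + ((1 - t) * t ^ 2 - (1 - t) * t ^ 2 * z ^ (P + 1)
        - (1 - t) ^ 3 * t * z ^ (P + 1) / (1 - z))
        * ((z * r - (z * r) ^ (Q + 1)) / (1 - z * r)))
      + r ^ (Q + 1) * ((1 - t) * t ^ 2 * (z ^ (Q + 1) -
        (1 - t) * ((z - z ^ (P + 1) * z ^ (Q + 1)) / (1 - z)))) := by
    rw [split, adjWeight_sum_last hz (by omega) (by omega), Nat.sub_zero,
      adjWeight_sum_zero_zero hz (by omega) (by omega), pow_add z (P + 1) (Q + 1)]
    congr 2
    refine lin (fun d => ∑ a ∈ Finset.range (P + 1 + d + 1),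
      adjWeight t (P + 1) (Q + 1) 0 d a * z ^ a) _ _ fun d hd => ?_
    rw [adjWeight_sum_zero_mid hz (by omega) (by omega) (by omega), pow_add z (P + 1)]
    ring
  have row : ∀ i < P, ∑ d ∈ Finset.range (Q + 1 + 1), r ^ d *
      ∑ a ∈ Finset.range (P + 1 - (i + 1) + d + 1),
        adjWeight t (P + 1) (Q + 1) (i + 1) d a * z ^ a =
      (1 - t) ^ 2 * t * (1 + (z - z ^ (P + 1 - (i + 1))) / (1 - z))
      + (((1 - t) ^ 2 * t * (1 + (1 - t) * (z / (1 - z)))) * ((r - r ^ (Q + 1)) / (1 - r))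
      + (-((1 - t) ^ 3 * t * z ^ (P + 1 - (i + 1)) / (1 - z)))
        * ((z * r - (z * r) ^ (Q + 1)) / (1 - z * r)))
      + r ^ (Q + 1) * ((1 - t) * t ^ 2 * (z ^ (Q + 1) -
        (1 - t) * ((z - z ^ (P + 1 - (i + 1)) * z ^ (Q + 1)) / (1 - z)))) := by
    intro i hi
    rw [split, adjWeight_sum_last hz (by omega) (by omega),
      adjWeight_sum_plain_zero hz (by omega) (by omega) (by omega),
      pow_add z (P + 1 - (i + 1)) (Q + 1)]
    congr 2
    refine lin (fun d => ∑ a ∈ Finset.range (P + 1 - (i + 1) + d + 1),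
      adjWeight t (P + 1) (Q + 1) (i + 1) d a * z ^ a) _ _ fun d hd => ?_
    rw [adjWeight_sum_plain_mid hz (by omega) (by omega) (by omega) (by omega),
      pow_add z (P + 1 - (i + 1))]
    ring
  -- The weight (zr)^e turns z^(p-e) into z^p r^e, so the sum over e again has only the ratios zr
  -- and r.
  have rows : ∀ (g : ℕ → K) (α β : K), (∀ i < P, g (i + 1) = α + β * z ^ (P + 1 - (i + 1))) →
      ∑ i ∈ Finset.range P, (z * r) ^ (i + 1) * g (i + 1) =
      α * ((z * r - (z * r) ^ (P + 1)) / (1 - z * r))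
        + β * z ^ (P + 1) * ((r - r ^ (P + 1)) / (1 - r)) := by
    intro g α β h
    rw [← sum_range_pow_succ hr, ← sum_range_pow_succ hzr, Finset.mul_sum, Finset.mul_sum,
      ← Finset.sum_add_distrib]
    refine Finset.sum_congr rfl fun i hi => ?_
    have hi := Finset.mem_range.1 hi
    rw [h i hi, pow_sub₀ z hz0 (by omega), mul_pow]
    have : z ^ (i + 1) ≠ 0 := pow_ne_zero _ hz0
    field_simp
  rw [adjSum, Finset.sum_range_succ, Finset.sum_range_succ', row0,
    rows (fun e => ∑ d ∈ Finset.range (Q + 1 + 1), r ^ d *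
      ∑ a ∈ Finset.range (P + 1 - e + d + 1), adjWeight t (P + 1) (Q + 1) e d a * z ^ a)
    ((1 - t) ^ 2 * t * (1 + z / (1 - z))
      + ((1 - t) ^ 2 * t * (1 + (1 - t) * (z / (1 - z)))) * ((r - r ^ (Q + 1)) / (1 - r))
      + r ^ (Q + 1) * ((1 - t) * t ^ 2 * (z ^ (Q + 1) - (1 - t) * (z / (1 - z)))))
    (-((1 - t) ^ 2 * t / (1 - z)) - (1 - t) ^ 3 * t / (1 - z)
        * ((z * r - (z * r) ^ (Q + 1)) / (1 - z * r))
      + r ^ (Q + 1) * ((1 - t) * t ^ 2 * (1 - t) * (z ^ (Q + 1) / (1 - z))))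
    (fun i hi => by
      rw [row i hi]
      ring)]
  simp only [adjWeight_boxed t (Nat.succ_pos P), zero_mul, Finset.sum_const_zero, mul_zero, add_zero,
    pow_zero, one_mul]
  rw [mul_pow, mul_pow]
  simp only [pow_succ]
  generalize z ^ P = zP
  generalize z ^ Q = zQ
  generalize r ^ P = rP
  generalize r ^ Q = rQ
  field_simp
  ring

end Field

end G2

/-! ### The sum over d and e of the standard contributions -/

namespace G2

/-- The sum of the standard contributions. -/
def stdSum {R : Type*} [CommRing R] (t x y : R) (p q : ℕ) : R :=
  decorSum t p fun e => (x ^ 4 * y ^ 2) ^ e * decorSum t q fun d =>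
    (x ^ 3 * y ^ 2) ^ d * midSum t x y (p - e + d) (q - d)

/-- The alternating sum over the Weyl group, multiplied by the dominant monomial. -/
def altSum {R : Type*} [CommRing R] (x y : R) (p q : ℕ) : R :=
  1 - y ^ q - x ^ p + x ^ p * y ^ (p + q) + x ^ (p + 3 * q) * y ^ q
    - x ^ (p + 3 * q) * y ^ (p + 3 * q) - x ^ (3 * p + 3 * q) * y ^ (p + q)
    + x ^ (3 * p + 3 * q) * y ^ (2 * p + 3 * q) + x ^ (3 * p + 6 * q) * y ^ (p + 3 * q)
    - x ^ (3 * p + 6 * q) * y ^ (2 * p + 4 * q) - x ^ (4 * p + 6 * q) * y ^ (2 * p + 3 * q)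
    + x ^ (4 * p + 6 * q) * y ^ (2 * p + 4 * q)

/-- The product of `1 - t 𝐱^α` over the positive roots. -/
def rootProd {R : Type*} [CommRing R] (t x y : R) : R :=
  (1 - t * x) * (1 - t * y) * (1 - t * (x * y)) * (1 - t * (x ^ 2 * y)) * (1 - t * (x ^ 3 * y)) *
    (1 - t * (x ^ 3 * y ^ 2))

section Field

variable {K : Type*} [Field K] {t x y : K}

/-- With m = p - e + d and n = q - d every monomial of the closed form is a power in d and in e, so
two more decorated geometric series suffice. Only the shape of that closed form matters, which is
why its coefficients are left arbitrary. -/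
theorem stdSum_of_midSum_eq (hx : x ≠ 0) (hy : y ≠ 0) (h1 : 1 - x ≠ 0)
    (h3 : 1 - x * y ≠ 0) (h4 : 1 - x ^ 3 * y ≠ 0) (h5 : 1 - x ^ 3 * y ^ 2 ≠ 0)
    (h7 : 1 - x ^ 4 * y ^ 2 ≠ 0) (A B C E : K)
    (h : ∀ m n, midSum t x y m n = A * (1 - x ^ m) - B * y ^ n * (1 - (x * y) ^ m)
      + C * x ^ m * (x ^ 3 * y) ^ n * (1 - (x ^ 2 * y) ^ m)
      - E * (x * y) ^ m * (x ^ 3 * y ^ 3) ^ n * (1 - (x ^ 2 * y) ^ m)) (p q : ℕ) :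
    stdSum t x y p q =
      ratio t (x ^ 4 * y ^ 2) * (1 - (x ^ 4 * y ^ 2) ^ p) *
        (A * ratio t (x ^ 3 * y ^ 2) * (1 - (x ^ 3 * y ^ 2) ^ q)
          - B * y ^ q * ratio t (x ^ 3 * y) * (1 - (x ^ 3 * y) ^ q))
      + x ^ p * ratio t (x ^ 3 * y ^ 2) * (1 - (x ^ 3 * y ^ 2) ^ p) *
        (C * (x ^ 3 * y) ^ q * ratio t (x * y) * (1 - (x * y) ^ q)
          - A * ratio t (x ^ 4 * y ^ 2) * (1 - (x ^ 4 * y ^ 2) ^ q))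
      + (x * y) ^ p * ratio t (x ^ 3 * y) * (1 - (x ^ 3 * y) ^ p) *
        (B * y ^ q * ratio t (x ^ 4 * y ^ 2) * (1 - (x ^ 4 * y ^ 2) ^ q)
          - E * (x ^ 3 * y ^ 3) ^ q * ratio t x * (1 - x ^ q))
      - (x ^ 3 * y) ^ p * ratio t (x * y) * (1 - (x * y) ^ p) *
        (C * (x ^ 3 * y) ^ q * ratio t (x ^ 3 * y ^ 2) * (1 - (x ^ 3 * y ^ 2) ^ q))
      + (x ^ 3 * y ^ 2) ^ p * ratio t x * (1 - x ^ p) *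
        (E * (x ^ 3 * y ^ 3) ^ q * ratio t (x ^ 3 * y) * (1 - (x ^ 3 * y) ^ q)) := by
  have inner : ∀ e ≤ p, (x ^ 4 * y ^ 2) ^ e * decorSum t q (fun d =>
      (x ^ 3 * y ^ 2) ^ d * midSum t x y (p - e + d) (q - d)) =
      (A * ratio t (x ^ 3 * y ^ 2) * (1 - (x ^ 3 * y ^ 2) ^ q)
          - B * y ^ q * ratio t (x ^ 3 * y) * (1 - (x ^ 3 * y) ^ q)) * (x ^ 4 * y ^ 2) ^ e
      + x ^ p * (C * (x ^ 3 * y) ^ q * ratio t (x * y) * (1 - (x * y) ^ q)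
          - A * ratio t (x ^ 4 * y ^ 2) * (1 - (x ^ 4 * y ^ 2) ^ q)) * (x ^ 3 * y ^ 2) ^ e
      + (x * y) ^ p * (B * y ^ q * ratio t (x ^ 4 * y ^ 2) * (1 - (x ^ 4 * y ^ 2) ^ q)
          - E * (x ^ 3 * y ^ 3) ^ q * ratio t x * (1 - x ^ q)) * (x ^ 3 * y) ^ e
      - (x ^ 3 * y) ^ p * (C * (x ^ 3 * y) ^ q * ratio t (x ^ 3 * y ^ 2)
          * (1 - (x ^ 3 * y ^ 2) ^ q)) * (x * y) ^ e
      + (x ^ 3 * y ^ 2) ^ p * (E * (x ^ 3 * y ^ 3) ^ q * ratio t (x ^ 3 * y)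
          * (1 - (x ^ 3 * y) ^ q)) * x ^ e := by
    intro e he
    have e1 : x ^ e ≠ 0 := pow_ne_zero _ hx
    have e2 : y ^ e ≠ 0 := pow_ne_zero _ hy
    have key : ∀ d ≤ q, (x ^ 3 * y ^ 2) ^ d * midSum t x y (p - e + d) (q - d) =
        A * (x ^ 3 * y ^ 2) ^ d
        - A * (x ^ p * (x ^ e)⁻¹) * (x ^ 4 * y ^ 2) ^ d
        - B * y ^ q * (x ^ 3 * y) ^ d
        + B * y ^ q * ((x * y) ^ p * ((x * y) ^ e)⁻¹) * (x ^ 4 * y ^ 2) ^ d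
        + C * (x ^ 3 * y) ^ q * (x ^ p * (x ^ e)⁻¹) * (x * y) ^ d
        - C * (x ^ 3 * y) ^ q * ((x ^ 3 * y) ^ p * ((x ^ 3 * y) ^ e)⁻¹) * (x ^ 3 * y ^ 2) ^ d
        - E * (x ^ 3 * y ^ 3) ^ q * ((x * y) ^ p * ((x * y) ^ e)⁻¹) * x ^ d
        + E * (x ^ 3 * y ^ 3) ^ q * ((x ^ 3 * y ^ 2) ^ p * ((x ^ 3 * y ^ 2) ^ e)⁻¹)
          * (x ^ 3 * y) ^ d := by
      intro d hd
      have d1 : x ^ d ≠ 0 := pow_ne_zero _ hx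
      have d2 : y ^ d ≠ 0 := pow_ne_zero _ hy
      rw [h]
      simp only [mul_pow, ← pow_mul, mul_comm _ (p - e + d), mul_comm _ (q - d)]
      simp only [pow_mul]
      simp only [pow_add, pow_sub₀ x hx he, pow_sub₀ y hy he, pow_sub₀ x hx hd, pow_sub₀ y hy hd]
      field_simp
      ring
    rw [decorSum_congr t key]
    simp only [decorSum_add, decorSum_sub, decorSum_const_mul]
    rw [decorSum_pow h1, decorSum_pow h3, decorSum_pow h4, decorSum_pow h5, decorSum_pow h7]
    generalize ratio t x = r1
    generalize ratio t (x * y) = r3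
    generalize ratio t (x ^ 3 * y) = r4
    generalize ratio t (x ^ 3 * y ^ 2) = r5
    generalize ratio t (x ^ 4 * y ^ 2) = r6
    simp only [mul_pow, ← pow_mul, mul_comm _ e, mul_comm _ p, mul_comm _ q]
    simp only [pow_mul]
    field_simp
    ring
  rw [stdSum, decorSum_congr t inner]
  simp only [decorSum_add, decorSum_sub, decorSum_const_mul]
  rw [decorSum_pow h1, decorSum_pow h3, decorSum_pow h4, decorSum_pow h5, decorSum_pow h7]
  ring

end Field

end G2

/-! ### Cancellation between standard and adjusted contributions -/

namespace G2

section Field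

variable {K : Type*} [Field K] {t x y : K}

/-- The standard and the adjusted contributions add up to the alternating sum. -/
theorem stdSum_add_adjSum (hx : x ≠ 0) (hy : y ≠ 0) (h1 : 1 - x ≠ 0) (h2 : 1 - y ≠ 0)
    (h3 : 1 - x * y ≠ 0) (h4 : 1 - x ^ 3 * y ≠ 0) (h5 : 1 - x ^ 3 * y ^ 2 ≠ 0)
    (h6 : 1 - x ^ 2 * y ≠ 0) (h7 : 1 + x ^ 2 * y ≠ 0) {p q : ℕ} (hp : 0 < p) (hq : 0 < q) :
    stdSum t x y p q + x ^ 2 * y * ratio t y * (adjSum t x (x ^ 3 * y ^ 2) p q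
      - y ^ q * adjSum t (x * y) (x ^ 3 * y) p q) =
      rootProd t x y / rootProd 1 x y * altSum x y p q := by
  have h8 : 1 - x ^ 4 * y ^ 2 ≠ 0 := by
    rw [show 1 - x ^ 4 * y ^ 2 = (1 - x ^ 2 * y) * (1 + x ^ 2 * y) by ring]
    exact mul_ne_zero h6 h7
  have h3' : 1 - y * x ≠ 0 := by rwa [mul_comm y]
  have h4' : 1 - y * x ^ 3 ≠ 0 := by rwa [mul_comm y]
  have h5' : 1 - y ^ 2 * x ^ 3 ≠ 0 := by rwa [mul_comm (y ^ 2)]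
  have h6' : 1 - y * x ^ 2 ≠ 0 := by rwa [mul_comm y]
  have h8' : 1 - y ^ 2 * x ^ 4 ≠ 0 := by rwa [mul_comm (y ^ 2)]
  have w1 : x * (x ^ 3 * y ^ 2) = x ^ 4 * y ^ 2 := by ring
  have w2 : x * y * (x ^ 3 * y) = x ^ 4 * y ^ 2 := by ring
  rw [stdSum_of_midSum_eq hx hy h1 h3 h4 h5 h8 _ _ _ _ (midSum_eq hx hy h1 h2 h3 h4 h5 h6),
    adjSum_eq hx h1 h5 (by rwa [w1]) hp hq,
    adjSum_eq (mul_ne_zero hx hy) h3 h4 (by rwa [w2]) hp hq, w1, w2]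
  set A := ratio t y * ratio t x * (1 - x * y * t + x ^ 2 * y * (1 - t) ^ 2 - x ^ 3 * y * t
    + x ^ 4 * y ^ 2 * t ^ 2) / ((1 - x * y) * (1 - x ^ 3 * y)) with hA
  set B := ratio t y * ratio t (x * y) * (1 - x * t + x ^ 2 * y * (1 - t) ^ 2 - x ^ 3 * y ^ 2 * t
    + x ^ 4 * y ^ 2 * t ^ 2) / ((1 - x) * (1 - x ^ 3 * y ^ 2)) with hB
  set C := ratio t y * ratio t x * ratio t (x ^ 2 * y) * ratio t (x ^ 3 * y) with hC
  set E := ratio t y * ratio t (x * y) * ratio t (x ^ 2 * y) * ratio t (x ^ 3 * y ^ 2) with hE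
  -- In `i1` and `i2` the adjusted term supplies exactly what A and B lack for the full product over
  -- the roots, and the denominator 1 - x⁴y² disappears.
  have i1 : A * ratio t (x ^ 3 * y ^ 2) * ratio t (x ^ 4 * y ^ 2) + x ^ 2 * y * ratio t y *
      ((1 - t) * t * (1 - t * x) * (1 - t * (x ^ 3 * y ^ 2))
        / ((1 - x) * (1 - x ^ 3 * y ^ 2) * (1 - x ^ 4 * y ^ 2))) =
      rootProd t x y / rootProd 1 x y := by
    simp only [hA, ratio, rootProd, one_mul]
    field_simp
    ring
  have i2 : B * ratio t (x ^ 3 * y) * ratio t (x ^ 4 * y ^ 2) + x ^ 2 * y * ratio t y *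
      ((1 - t) * t * (1 - t * (x * y)) * (1 - t * (x ^ 3 * y))
        / ((1 - x * y) * (1 - x ^ 3 * y) * (1 - x ^ 4 * y ^ 2))) =
      rootProd t x y / rootProd 1 x y := by
    simp only [hB, ratio, rootProd, one_mul]
    field_simp
    ring
  have i3 : C * ratio t (x ^ 3 * y ^ 2) * ratio t (x * y) = rootProd t x y / rootProd 1 x y := by
    simp only [hC, ratio, rootProd, one_mul]
    field_simp
  have i4 : E * ratio t (x ^ 3 * y) * ratio t x = rootProd t x y / rootProd 1 x y := by
    simp only [hE, ratio, rootProd, one_mul]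
    field_simp
  have i5 : (1 - t) * t * ((1 - t) * (1 - t * (x ^ 4 * y ^ 2))) * x ^ 2 * y * ratio t y *
      (1 / ((1 - x * y) * (1 - x ^ 3 * y) * (1 - x ^ 4 * y ^ 2))
        - 1 / ((1 - x) * (1 - x ^ 3 * y ^ 2) * (1 - x ^ 4 * y ^ 2))) =
      -- This relation removes the terms in x^(3q) y^(2q) (1 - (x⁴y²)^p), which have no counterpart
      -- in the Weyl sum.
      (A * ratio t (x ^ 3 * y ^ 2) - B * ratio t (x ^ 3 * y)) * ratio t (x ^ 4 * y ^ 2) := by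
    simp only [hA, hB, ratio]
    field_simp
    ring
  clear_value A B C E
  generalize rootProd t x y / rootProd 1 x y = Q at *
  simp only [div_eq_mul_inv] at i1 i2 i3 i4 i5 ⊢
  generalize ((1 - x) * (1 - x ^ 3 * y ^ 2) * (1 - x ^ 4 * y ^ 2))⁻¹ = j1 at *
  generalize ((1 - x * y) * (1 - x ^ 3 * y) * (1 - x ^ 4 * y ^ 2))⁻¹ = j2 at *
  generalize ratio t x = r1 at *
  generalize ratio t y = r2 at *
  generalize ratio t (x * y) = r3 at *
  generalize ratio t (x ^ 3 * y) = r4 at *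
  generalize ratio t (x ^ 3 * y ^ 2) = r5 at *
  generalize ratio t (x ^ 4 * y ^ 2) = r6 at *
  -- The powers x^p, y^p, x^q, y^q may be treated as independent variables a, b, u, v; the identity
  -- is then a combination of `i1` to `i5`.
  have main : ∀ a b u v : K, 
      r6 * (1 - (a ^ 4 * b ^ 2)) * (A * r5 * (1 - u ^ 3 * v ^ 2) - B * v * r4 * (1 - u ^ 3 * v))
      + a * r5 * (1 - a ^ 3 * b ^ 2) *
        (C * (u ^ 3 * v) * r3 * (1 - u * v) - A * r6 * (1 - u ^ 4 * v ^ 2))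
      + a * b * r4 * (1 - a ^ 3 * b) *
        (B * v * r6 * (1 - u ^ 4 * v ^ 2) - E * (u ^ 3 * v ^ 3) * r1 * (1 - u))
      - a ^ 3 * b * r3 * (1 - a * b) * (C * (u ^ 3 * v) * r5 * (1 - u ^ 3 * v ^ 2))
      + a ^ 3 * b ^ 2 * r1 * (1 - a) * (E * (u ^ 3 * v ^ 3) * r4 * (1 - u ^ 3 * v))
      + x ^ 2 * y * r2 *
        ((1 - t) * t * ((1 - t * x) * (1 - t * (x ^ 3 * y ^ 2)) *
            (1 - a + a * (u ^ 4 * v ^ 2) - a ^ 4 * b ^ 2 * (u ^ 4 * v ^ 2))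
            - (1 - t) * (1 - t * (x ^ 4 * y ^ 2)) * (u ^ 3 * v ^ 2) * (1 - a ^ 4 * b ^ 2)) * j1
          - v * ((1 - t) * t * ((1 - t * (x * y)) * (1 - t * (x ^ 3 * y)) *
            (1 - a * b + a * b * (u ^ 4 * v ^ 2) - a ^ 4 * b ^ 2 * (u ^ 4 * v ^ 2))
            - (1 - t) * (1 - t * (x ^ 4 * y ^ 2)) * (u ^ 3 * v) * (1 - a ^ 4 * b ^ 2)) * j2)) =
      Q * (1 - v - a + a * (b * v) + a * u ^ 3 * v - a * u ^ 3 * (b * v ^ 3)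
        - a ^ 3 * u ^ 3 * (b * v) + a ^ 3 * u ^ 3 * (b ^ 2 * v ^ 3) + a ^ 3 * u ^ 6 * (b * v ^ 3)
        - a ^ 3 * u ^ 6 * (b ^ 2 * v ^ 4) - a ^ 4 * u ^ 6 * (b ^ 2 * v ^ 3)
        + a ^ 4 * u ^ 6 * (b ^ 2 * v ^ 4)) := by
    intro a b u v
    linear_combination (1 - a + a * (u ^ 4 * v ^ 2) - a ^ 4 * b ^ 2 * (u ^ 4 * v ^ 2)) * i1
      - v * (1 - a * b + a * b * (u ^ 4 * v ^ 2) - a ^ 4 * b ^ 2 * (u ^ 4 * v ^ 2)) * i2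
      + (a * (1 - a ^ 3 * b ^ 2) * (u ^ 3 * v) * (1 - u * v)
        - a ^ 3 * b * (1 - a * b) * (u ^ 3 * v) * (1 - u ^ 3 * v ^ 2)) * i3
      + (-a * b * (1 - a ^ 3 * b) * (u ^ 3 * v ^ 3) * (1 - u)
        + a ^ 3 * b ^ 2 * (1 - a) * (u ^ 3 * v ^ 3) * (1 - u ^ 3 * v)) * i4
      + u ^ 3 * v ^ 2 * (1 - a ^ 4 * b ^ 2) * i5
  convert main (x ^ p) (y ^ p) (x ^ q) (y ^ q) using 1
  · ring
  · rw [altSum]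
    ring

end Field

end G2

/-! ### Patterns in slack coordinates -/

namespace G2

theorem decor_congr {R : Type*} [CommRing R] (t : R) {C B C' B' : Prop} [Decidable C] [Decidable B]
    [Decidable C'] [Decidable B'] (hC : C ↔ C') (hB : B ↔ B') : decor t C B = decor t C' B' := by
  simp only [decor, hC, hB]

/-- The part of the sum that comes from the adjusted contributions. -/
noncomputable def adjPart {R : Type*} [CommRing R] (t x y : R) (p q : ℕ) : R :=
  ∑ e ∈ Finset.range (p + 1), ∑ d ∈ Finset.range (q + 1), ∑ a ∈ Finset.range (p - e + d + 1),
    (x ^ 4 * y ^ 2) ^ e * (x ^ 3 * y ^ 2) ^ d * (x ^ 2 * y) * (adjWeight t p q e d a * x ^ a) *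
      decorSum t (q - d + a) fun f => y ^ f

namespace Pattern

section Flags

variable (p q : ℕ) (π : Pattern)

/-- Moving all subtracted terms to the other side gives inequalities in ℕ without subtraction or
division, which `omega` can use. -/
theorem isLittelmann_natCast_iff : π.IsLittelmann p q ↔
    (π.b ≤ π.a ∧ π.a + 2 * π.c + 2 * π.e ≤ p + 3 * π.b + 3 * π.d) ∧
    (π.c ≤ 2 * π.b ∧ π.b + 2 * π.d ≤ q + π.c + π.e) ∧
    (2 * π.d ≤ π.c ∧ π.c + 2 * π.e ≤ p + 3 * π.d) ∧
    (π.e ≤ π.d ∧ π.d ≤ q + π.e) ∧ π.e ≤ p ∧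
    π.f + 2 * π.b + 2 * π.d ≤ q + π.a + π.c + π.e := by
  have h : π.IsLittelmann p q ↔ (∀ u, π.lower u ≤ π.val u ∧ π.val u ≤ π.upper p q u) := Iff.rfl
  rw [h]
  constructor
  · intro h
    have ha := h .a
    have hb := h .b
    have hc := h .c
    have hd := h .d
    have he := h .e
    have hf := h .f
    simp only [val, lower, upper, Int.cast_natCast] at ha hb hc hd he hf
    refine ⟨⟨?_, ?_⟩, ⟨?_, ?_⟩, ⟨?_, ?_⟩, ⟨?_, ?_⟩, ?_, ?_⟩ <;> rify <;> rify at ha hb hc hd he hf <;>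
      linarith
  · rintro ⟨ha, hb, hc, hd, he, hf⟩ (_ | _ | _ | _ | _ | _) <;>
      simp only [val, lower, upper, Int.cast_natCast] <;> rify <;>
      rify at ha hb hc hd he hf <;> constructor <;> linarith

theorem circled_a : π.Circled .a ↔ π.a = π.b := by simp [Circled, val, lower]

theorem circled_b : π.Circled .b ↔ 2 * π.b = π.c := by
  simp only [Circled, val, lower]
  rw [eq_div_iff two_ne_zero, mul_comm]
  exact_mod_cast Iff.rfl

theorem circled_c : π.Circled .c ↔ π.c = 2 * π.d := by
  simp only [Circled, val, lower]; exact_mod_cast Iff.rfl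

theorem circled_d : π.Circled .d ↔ π.d = π.e := by simp [Circled, val, lower]

theorem circled_e : π.Circled .e ↔ π.e = 0 := by simp [Circled, val, lower]

theorem circled_f : π.Circled .f ↔ π.f = 0 := by simp [Circled, val, lower]

theorem boxed_a : π.Boxed p q .a ↔ π.a + 2 * π.c + 2 * π.e = p + 3 * π.b + 3 * π.d := by
  simp only [Boxed, val, upper, Int.cast_natCast]
  constructor <;> intro h
  · rify at h ⊢; linarith
  · rify at h ⊢; linarith

theorem boxed_b : π.Boxed p q .b ↔ π.b + 2 * π.d = q + π.c + π.e := by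
  simp only [Boxed, val, upper, Int.cast_natCast]
  constructor <;> intro h
  · rify at h ⊢; linarith
  · rify at h ⊢; linarith

theorem boxed_c : π.Boxed p q .c ↔ π.c + 2 * π.e = p + 3 * π.d := by
  simp only [Boxed, val, upper, Int.cast_natCast]
  constructor <;> intro h
  · rify at h ⊢; linarith
  · rify at h ⊢; linarith

theorem boxed_d : π.Boxed p q .d ↔ π.d = q + π.e := by
  simp only [Boxed, val, upper, Int.cast_natCast]; exact_mod_cast Iff.rfl

theorem boxed_e : π.Boxed p q .e ↔ π.e = p := by
  simp only [Boxed, val, upper, Int.cast_natCast]; exact_mod_cast Iff.rfl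

theorem boxed_f : π.Boxed p q .f ↔ π.f + 2 * π.b + 2 * π.d = q + π.a + π.c + π.e := by
  simp only [Boxed, val, upper, Int.cast_natCast]
  constructor <;> intro h
  · rify at h ⊢; linarith
  · rify at h ⊢; linarith

end Flags

/-- The pattern with given slacks. -/
def ofSlack (e d c b a f : ℕ) : Pattern :=
  ⟨a + (b + (d + e)), b + (d + e), c + 2 * (d + e), d + e, e, f⟩

/-- The slack of b is taken from d and not from c/2, so its lower end is half the slack of c,
rounded up. The other slacks start at 0. -/
theorem sum_littelmannPatterns {M : Type*} [AddCommMonoid M] (p q : ℕ) (F : Pattern → M) :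
    ∑ π ∈ littelmannPatterns p q, F π =
      ∑ e ∈ Finset.range (p + 1), ∑ d ∈ Finset.range (q + 1), ∑ c ∈ Finset.range (p - e + d + 1),
      ∑ b ∈ Finset.Icc ((c + 1) / 2) (q - d + c),
      ∑ a ∈ Finset.range (p - e + d + 2 * b - 2 * c + 1),
      ∑ f ∈ Finset.range (q - d + c + a - b + 1), F (ofSlack e d c b a f) := by
  simp only [Finset.sum_sigma']
  refine Finset.sum_bij' (fun π _ => ⟨π.e, π.d - π.e, π.c - 2 * π.d, π.b - π.d, π.a - π.b, π.f⟩)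
    (fun s _ => ofSlack s.1 s.2.1 s.2.2.1 s.2.2.2.1 s.2.2.2.2.1 s.2.2.2.2.2) ?_ ?_ ?_ ?_ ?_
  · intro π hπ
    rw [littelmannPatterns, Set.Finite.mem_toFinset, Set.mem_ofPred_eq,
      isLittelmann_natCast_iff] at hπ
    simp only [Finset.mem_sigma, Finset.mem_range, Finset.mem_Icc]
    omega
  · rintro ⟨e, d, c, b, a, f⟩ hs
    rw [littelmannPatterns, Set.Finite.mem_toFinset, Set.mem_ofPred_eq, isLittelmann_natCast_iff]
    simp only [Finset.mem_sigma, Finset.mem_range, Finset.mem_Icc] at hs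
    simp only [ofSlack]
    omega
  · intro π hπ
    rw [littelmannPatterns, Set.Finite.mem_toFinset, Set.mem_ofPred_eq,
      isLittelmann_natCast_iff] at hπ
    ext <;> simp only [ofSlack] <;> omega
  · rintro ⟨e, d, c, b, a, f⟩ _
    simp [ofSlack]
  · intro π hπ
    rw [littelmannPatterns, Set.Finite.mem_toFinset, Set.mem_ofPred_eq,
      isLittelmann_natCast_iff] at hπ
    congr 1
    ext <;> simp only [ofSlack] <;> omega

open Classical in
/-- The standard contribution over a commutative ring, with `t` in place of `1 / q`. -/
noncomputable def stdWeight {R : Type*} [CommRing R] (t : R) (ℓ₁ ℓ₂ : ℤ) (π : Pattern) : R :=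
  decor t (π.Circled .a) (π.Boxed ℓ₁ ℓ₂ .a) * decor t (π.Circled .b) (π.Boxed ℓ₁ ℓ₂ .b) *
    decor t (π.Circled .c) (π.Boxed ℓ₁ ℓ₂ .c) * decor t (π.Circled .d) (π.Boxed ℓ₁ ℓ₂ .d) *
    decor t (π.Circled .e) (π.Boxed ℓ₁ ℓ₂ .e) * decor t (π.Circled .f) (π.Boxed ℓ₁ ℓ₂ .f)

open Classical in
/-- The adjusted contribution over a commutative ring, with `t` in place of `1 / q`. -/
noncomputable def adjustedWeight {R : Type*} [CommRing R] (t : R) (ℓ₁ ℓ₂ : ℤ) (π : Pattern) : R :=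
  (if ¬ π.BadMiddle then 0 else
    adjFactor t (π.Circled .e) (π.Plain ℓ₁ ℓ₂ .e) (π.Circled .d) (π.Plain ℓ₁ ℓ₂ .d)
      (π.Boxed ℓ₁ ℓ₂ .d) (π.Circled .a) (π.Plain ℓ₁ ℓ₂ .a) (π.Boxed ℓ₁ ℓ₂ .a) π.Special) *
    decor t (π.Circled .f) (π.Boxed ℓ₁ ℓ₂ .f)

section Sum

variable {R : Type*} [CommRing R] (t x y : R) (p q : ℕ)

open Classical in
theorem sum_stdWeight :
    ∑ π ∈ littelmannPatterns p q,
      π.stdWeight t p q * x ^ (π.a + π.c + π.e) * y ^ (π.b + π.d + π.f) = stdSum t x y p q := by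
  rw [sum_littelmannPatterns]
  simp only [stdSum, midSum, decorSum, Finset.mul_sum]
  refine Finset.sum_congr rfl fun e he => Finset.sum_congr rfl fun d hd =>
    Finset.sum_congr rfl fun c hc => Finset.sum_congr rfl fun b hb =>
    Finset.sum_congr rfl fun a ha => Finset.sum_congr rfl fun f hf => ?_
  simp only [Finset.mem_range, Finset.mem_Icc] at he hd hc hb ha hf
  rw [stdWeight,
    decor_congr t (C := (ofSlack e d c b a f).Circled .a)
      (C' := a = 0) (B' := a = p - e + d + 2 * b - 2 * c)
      (by rw [circled_a]; simp only [ofSlack]; omega)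
      (by rw [boxed_a]; simp only [ofSlack]; omega),
    decor_congr t (C := (ofSlack e d c b a f).Circled .b)
      (C' := 2 * b = c) (B' := b = q - d + c)
      (by rw [circled_b]; simp only [ofSlack]; omega)
      (by rw [boxed_b]; simp only [ofSlack]; omega),
    decor_congr t (C := (ofSlack e d c b a f).Circled .c)
      (C' := c = 0) (B' := c = p - e + d)
      (by rw [circled_c]; simp only [ofSlack]; omega)
      (by rw [boxed_c]; simp only [ofSlack]; omega),
    decor_congr t (C := (ofSlack e d c b a f).Circled .d)
      (C' := d = 0) (B' := d = q)
      (by rw [circled_d]; simp only [ofSlack]; omega)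
      (by rw [boxed_d]; simp only [ofSlack]; omega),
    decor_congr t (C := (ofSlack e d c b a f).Circled .e)
      (C' := e = 0) (B' := e = p)
      (by rw [circled_e]; simp only [ofSlack])
      (by rw [boxed_e]; simp only [ofSlack]),
    decor_congr t (C := (ofSlack e d c b a f).Circled .f)
      (C' := f = 0) (B' := f = q - d + c + a - b)
      (by rw [circled_f]; simp only [ofSlack])
      (by rw [boxed_f]; simp only [ofSlack]; omega)]
  simp only [ofSlack, endWeight]
  ring

theorem adjFactor_ofSlack {e d a f : ℕ} (he : e ≤ p) :
    adjFactor t ((ofSlack e d 1 1 a f).Circled .e) ((ofSlack e d 1 1 a f).Plain p q .e)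
      ((ofSlack e d 1 1 a f).Circled .d) ((ofSlack e d 1 1 a f).Plain p q .d)
      ((ofSlack e d 1 1 a f).Boxed p q .d) ((ofSlack e d 1 1 a f).Circled .a)
      ((ofSlack e d 1 1 a f).Plain p q .a) ((ofSlack e d 1 1 a f).Boxed p q .a)
      (ofSlack e d 1 1 a f).Special = adjWeight t p q e d a := by
  have h1 : (ofSlack e d 1 1 a f).Circled .e ↔ e = 0 := by rw [circled_e]; simp only [ofSlack]
  have h2 : (ofSlack e d 1 1 a f).Boxed p q .e ↔ e = p := by rw [boxed_e]; simp only [ofSlack]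
  have h3 : (ofSlack e d 1 1 a f).Circled .d ↔ d = 0 := by
    rw [circled_d]; simp only [ofSlack]; omega
  have h4 : (ofSlack e d 1 1 a f).Boxed p q .d ↔ d = q := by
    rw [boxed_d]; simp only [ofSlack]; omega
  have h5 : (ofSlack e d 1 1 a f).Circled .a ↔ a = 0 := by
    rw [circled_a]; simp only [ofSlack]; omega
  have h6 : (ofSlack e d 1 1 a f).Boxed p q .a ↔ a = p - e + d := by
    rw [boxed_a]; simp only [ofSlack]; omega
  -- With b = d + 1 for the actual entries, a = 2d + 1 - e says a - b = d - e.
  have h7 : (ofSlack e d 1 1 a f).Special ↔ a = d := by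
    rw [Special]; simp only [ofSlack]; omega
  simp only [adjWeight, Plain, h1, h2, h3, h4, h5, h6, h7, ne_eq]

open Classical in
theorem sum_adjustedWeight (hp : 0 < p) :
    ∑ π ∈ littelmannPatterns p q,
      π.adjustedWeight t p q * x ^ (π.a + π.c + π.e) * y ^ (π.b + π.d + π.f) =
        adjPart t x y p q := by
  rw [sum_littelmannPatterns, adjPart]
  refine Finset.sum_congr rfl fun e he => Finset.sum_congr rfl fun d hd => ?_
  simp only [Finset.mem_range] at he hd
  have bad : ∀ c b a f, (ofSlack e d c b a f).BadMiddle ↔ b = 1 ∧ c = 1 := by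
    intro c b a f
    simp only [BadMiddle, ofSlack]
    omega
  -- In this corner c has no slack, so c = 2d + 1 is impossible; the other side vanishes because e
  -- is boxed.
  by_cases hm : p - e + d = 0
  · obtain rfl : e = p := by omega
    simp only [adjWeight_boxed t hp, zero_mul, mul_zero, Finset.sum_const_zero]
    refine Finset.sum_eq_zero fun c hc => Finset.sum_eq_zero fun b _ =>
      Finset.sum_eq_zero fun a _ => Finset.sum_eq_zero fun f _ => ?_
    have : c ≠ 1 := by have := Finset.mem_range.1 hc; omega
    simp [adjustedWeight, bad, this]
  · rw [Finset.sum_eq_single 1, Finset.sum_eq_single 1]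
    · have e1 : p - e + d + 2 * 1 - 2 * 1 = p - e + d := by omega
      rw [e1]
      refine Finset.sum_congr rfl fun a _ => ?_
      have e2 : q - d + 1 + a - 1 = q - d + a := by omega
      rw [e2, decorSum, Finset.mul_sum]
      refine Finset.sum_congr rfl fun f _ => ?_
      rw [adjustedWeight, if_neg (by simp [bad]), adjFactor_ofSlack t p q (by omega),
        decor_congr t (C' := f = 0) (B' := f = q - d + a)
          (by rw [circled_f]; simp only [ofSlack])
          (by rw [boxed_f]; simp only [ofSlack]; omega)]
      simp only [ofSlack, endWeight]
      ring
    · intro b _ hb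
      simp [adjustedWeight, bad, hb]
    · intro h
      simp only [Finset.mem_Icc, not_and, not_le] at h
      omega
    · intro c _ hc
      simp [adjustedWeight, bad, hc]
    · intro h
      simp only [Finset.mem_range, not_lt] at h
      omega

end Sum

end Pattern

/-- The sum over f is a multiple of 1 - y^(q-d+a). Its second term absorbs y^a into x^a and y^(-d)
into (x³y²)^d, giving the parameters xy and x³y; the product x⁴y² attached to e is unchanged. -/
theorem adjPart_eq {K : Type*} [Field K] {t x y : K} (hy : y ≠ 0) (h2 : 1 - y ≠ 0) (p q : ℕ) :
    adjPart t x y p q = x ^ 2 * y * ratio t y * (adjSum t x (x ^ 3 * y ^ 2) p q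
      - y ^ q * adjSum t (x * y) (x ^ 3 * y) p q) := by
  rw [adjPart, adjSum, adjSum, mul_sub]
  simp only [Finset.mul_sum, ← Finset.sum_sub_distrib]
  refine Finset.sum_congr rfl fun e _ => Finset.sum_congr rfl fun d hd =>
    Finset.sum_congr rfl fun a _ => ?_
  have hd : d ≤ q := by have := Finset.mem_range.1 hd; omega
  have : y ^ d ≠ 0 := pow_ne_zero _ hy
  rw [decorSum_pow h2, pow_add, pow_sub₀ y hy hd]
  simp only [mul_pow, ← pow_mul, mul_comm _ e, mul_comm _ d]
  simp only [pow_mul]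
  generalize adjWeight t p q e d a = w
  generalize ratio t y = r
  field_simp

end G2

namespace G2

/-! ### The sum over the Weyl group -/

/-- The reflection in `α₁` as an element of the Weyl group. -/
def reflection₁ : weylGroup := ⟨s₁, Subgroup.subset_closure (by simp)⟩

/-- The Coxeter element `s₁ s₂`. -/
def coxeter : weylGroup := reflection₁ * ⟨s₂, Subgroup.subset_closure (by simp)⟩

theorem reflection₁_apply (v : G2Weight) : reflection₁.1 v = (-v.1 + 3 * v.2, v.2) := s₁_apply v

theorem coxeter_apply (v : G2Weight) : coxeter.1 v = (2 * v.1 - 3 * v.2, v.1 - v.2) := by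
  change s₁ (s₂ v) = _
  rw [s₁_apply, s₂_apply]
  ext <;> simp
  ring

theorem coxeter_pow_succ_apply (k : ℕ) (v : G2Weight) :
    (coxeter ^ (k + 1)).1 v = coxeter.1 ((coxeter ^ k).1 v) := by
  rw [pow_succ']
  rfl

theorem coxeter_pow_apply (k : ℕ) (v : G2Weight) :
    (coxeter ^ k).1 v = (fun u : ℤ × ℤ => (2 * u.1 - 3 * u.2, u.1 - u.2))^[k] v := by
  induction k with
  | zero => rfl
  | succ k ih => rw [coxeter_pow_succ_apply, ih, coxeter_apply, Function.iterate_succ_apply']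

theorem coxeter_pow_six : coxeter ^ 6 = 1 := by
  apply Subtype.ext
  apply LinearEquiv.ext
  intro v
  rw [coxeter_pow_apply]
  simp only [Function.iterate_succ_apply, Function.iterate_zero_apply]
  ext <;> simp <;> ring

theorem reflection₁_mul_self : reflection₁ * reflection₁ = 1 := by
  apply Subtype.ext
  apply LinearEquiv.ext
  intro v
  change reflection₁.1 (reflection₁.1 v) = v
  rw [reflection₁_apply, reflection₁_apply]
  ext <;> simp

theorem coxeter_mul_reflection₁ : coxeter * reflection₁ = reflection₁ * coxeter ^ 5 := by
  apply Subtype.ext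
  apply LinearEquiv.ext
  intro v
  change coxeter.1 (reflection₁.1 v) = reflection₁.1 ((coxeter ^ 5).1 v)
  rw [coxeter_pow_apply]
  simp only [reflection₁_apply, coxeter_apply, Function.iterate_succ_apply,
    Function.iterate_zero_apply]
  ext <;> simp <;> ring

/-- The dihedral relations make this set of normal forms stable under left multiplication by the
generators, as s₂ is `reflection₁ * coxeter`. -/
theorem exists_eq_coxeter_pow (w : weylGroup) :
    ∃ k : ℕ, w = coxeter ^ k ∨ w = reflection₁ * coxeter ^ k := by
  have h1 : ∀ w : weylGroup, (∃ k : ℕ, w = coxeter ^ k ∨ w = reflection₁ * coxeter ^ k) →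
      ∃ k : ℕ, reflection₁ * w = coxeter ^ k ∨ reflection₁ * w = reflection₁ * coxeter ^ k := by
    rintro w ⟨k, rfl | rfl⟩
    · exact ⟨k, Or.inr rfl⟩
    · exact ⟨k, Or.inl (by rw [← mul_assoc, reflection₁_mul_self, one_mul])⟩
  have hc : ∀ w : weylGroup, (∃ k : ℕ, w = coxeter ^ k ∨ w = reflection₁ * coxeter ^ k) →
      ∃ k : ℕ, coxeter * w = coxeter ^ k ∨ coxeter * w = reflection₁ * coxeter ^ k := by
    rintro w ⟨k, rfl | rfl⟩
    · exact ⟨k + 1, Or.inl (pow_succ' _ _).symm⟩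
    · exact ⟨5 + k, Or.inr (by rw [← mul_assoc, coxeter_mul_reflection₁, pow_add, mul_assoc])⟩
  have e1 : (⟨s₂, Subgroup.subset_closure (by simp)⟩ : weylGroup) = reflection₁ * coxeter := by
    rw [coxeter, ← mul_assoc, reflection₁_mul_self, one_mul]
  obtain ⟨w, hw⟩ := w
  induction hw using Subgroup.closure_induction_left with
  | one => exact ⟨0, Or.inl rfl⟩
  | mul_left g hg w hw ih =>
    rcases hg with rfl | rfl
    · exact h1 _ ih
    · have := h1 _ (hc _ ih)
      rwa [← mul_assoc, ← e1] at this
  | inv_mul_cancel g hg w hw ih =>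
    rcases hg with rfl | rfl
    · have e : (⟨s₁⁻¹ * w, mul_mem (inv_mem (Subgroup.subset_closure (by simp))) hw⟩ : weylGroup) =
          reflection₁ * ⟨w, hw⟩ := by
        change reflection₁⁻¹ * ⟨w, hw⟩ = reflection₁ * ⟨w, hw⟩
        rw [inv_eq_of_mul_eq_one_left reflection₁_mul_self]
      rw [e]
      exact h1 _ ih
    · have e : (⟨s₂⁻¹ * w, mul_mem (inv_mem (Subgroup.subset_closure (by simp))) hw⟩ : weylGroup) =
          reflection₁ * (coxeter * ⟨w, hw⟩) := by
        change (⟨s₂, Subgroup.subset_closure (by simp)⟩ : weylGroup)⁻¹ * ⟨w, hw⟩ = _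
        rw [← mul_assoc, ← e1]
        congr 1
      rw [e]
      exact h1 _ (hc _ ih)

theorem sum_weylGroup {M : Type*} [AddCommMonoid M] (F : weylGroup → M) :
    ∑ w, F w = ∑ k ∈ Finset.range 6, (F (coxeter ^ k) + F (reflection₁ * coxeter ^ k)) := by
  let g : Bool × Fin 6 → weylGroup := fun i => cond i.1 reflection₁ 1 * coxeter ^ (i.2 : ℕ)
  have hg : Function.Bijective g := by
    constructor
    -- The twelve elements are told apart by their images of ρ = (5, 3), which are distinct.
    · let v : Bool × Fin 6 → ℤ × ℤ := fun i =>
        let u := (fun u : ℤ × ℤ => (2 * u.1 - 3 * u.2, u.1 - u.2))^[(i.2 : ℕ)] (5, 3)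
        cond i.1 (-u.1 + 3 * u.2, u.2) u
      have hv : ∀ i, (g i).1 (5, 3) = v i := by
        rintro ⟨b, k⟩
        cases b
        · change (1 * coxeter ^ (k : ℕ) : weylGroup).1 (5, 3) = _
          rw [one_mul, coxeter_pow_apply]
          rfl
        · change reflection₁.1 ((coxeter ^ (k : ℕ)).1 (5, 3)) = _
          rw [coxeter_pow_apply, reflection₁_apply]
          rfl
      have hinj : Function.Injective v := by decide
      intro i j hij
      exact hinj (by rw [← hv, ← hv, hij])
    · intro w
      obtain ⟨k, hk⟩ := exists_eq_coxeter_pow w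
      have hmod : coxeter ^ (k % 6) = coxeter ^ k := by
        conv_rhs => rw [← Nat.div_add_mod k 6, pow_add, pow_mul, coxeter_pow_six, one_pow, one_mul]
      rcases hk with rfl | rfl
      · exact ⟨(false, ⟨k % 6, Nat.mod_lt _ (by norm_num)⟩), by simp [g, hmod]⟩
      · exact ⟨(true, ⟨k % 6, Nat.mod_lt _ (by norm_num)⟩), by simp [g, hmod]⟩
  rw [← hg.sum_comp, Fintype.sum_prod_type_right, Finset.sum_range]
  refine Finset.sum_congr rfl fun k _ => ?_
  rw [Fintype.sum_bool, add_comm]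
  simp [g]

theorem sgn_mul (v w : weylGroup) : sgn (v * w) = sgn v * sgn w := by
  simp [sgn]

theorem det_eq (f : G2Weight →ₗ[ℤ] G2Weight) :
    LinearMap.det f = (f (1, 0)).1 * (f (0, 1)).2 - (f (0, 1)).1 * (f (1, 0)).2 := by
  rw [← LinearMap.det_toMatrix (Module.Basis.finTwoProd ℤ), Matrix.det_fin_two]
  simp [LinearMap.toMatrix_apply]

theorem sgn_reflection₁ : sgn reflection₁ = -1 := by
  rw [sgn, LinearEquiv.coe_det, det_eq]
  simp [reflection₁, s₁_apply]

theorem sgn_coxeter_pow (k : ℕ) : sgn (coxeter ^ k) = 1 := by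
  have h : sgn coxeter = 1 := by
    rw [sgn, LinearEquiv.coe_det, det_eq]
    simp [coxeter_apply]
  induction k with
  | zero => simp [sgn]
  | succ k ih => rw [pow_succ, sgn_mul, ih, h, one_mul]

section Field

variable {K : Type*} [Field K] {x y : K}

/-- The alternating sum over the Weyl group, made explicit. -/
theorem monom_mul_sum_sgn (hx : x ≠ 0) (hy : y ≠ 0) (p q : ℕ) :
    monom x y ((p : ℤ) • ϖ₁ + (q : ℤ) • ϖ₂) * ∑ w : weylGroup, (sgn w : K) *
      monom x y (w.1 ((p : ℤ) • ϖ₁ + (q : ℤ) • ϖ₂)) = altSum x y p q := by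
  have hl : (p : ℤ) • ϖ₁ + (q : ℤ) • ϖ₂ = ((2 * p + 3 * q : ℤ), (p + 2 * q : ℤ)) := by
    simp only [ϖ₁, ϖ₂]
    ext <;> simp <;> ring
  have hr : ∀ (w : weylGroup) v, (reflection₁ * w).1 v = reflection₁.1 (w.1 v) := fun _ _ => rfl
  rw [hl, sum_weylGroup, Finset.mul_sum]
  have mul_monom : ∀ (u v : ℤ × ℤ) (c : K),
      monom x y u * (c * monom x y v) = c * (x ^ (u.1 + v.1) * y ^ (u.2 + v.2)) := by
    intro u v c
    rw [monom, monom, zpow_add₀ hx, zpow_add₀ hy]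
    ring
  have pair : ∀ (i j k l : ℕ) {a b c d : ℤ}, a = i → b = j → c = k → d = l →
      1 * (x ^ a * y ^ b) + -1 * (x ^ c * y ^ d) = x ^ i * y ^ j - x ^ k * y ^ l := by
    rintro i j k l _ _ _ _ rfl rfl rfl rfl
    simp only [zpow_natCast]
    ring
  simp only [mul_add, mul_monom, hr, sgn_mul, sgn_reflection₁, sgn_coxeter_pow, reflection₁_apply,
    coxeter_pow_apply]
  simp only [Finset.sum_range_succ, Finset.sum_range_zero, Function.iterate_succ_apply,
    Function.iterate_zero_apply, zero_add]
  push_cast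
  -- The k-th pair lists the coordinates of λ + wλ for w = `coxeter ^ k` and w = `reflection₁ *
  -- coxeter ^ k`, where λ = pϖ₁ + qϖ₂.
  refine (congrArg₂ (· + ·) (congrArg₂ (· + ·) (congrArg₂ (· + ·) (congrArg₂ (· + ·)
    (congrArg₂ (· + ·)
    (pair (4 * p + 6 * q) (2 * p + 4 * q) (3 * p + 6 * q) (2 * p + 4 * q)
      (by push_cast; ring) (by push_cast; ring) (by push_cast; ring) (by push_cast; ring))
    (pair (3 * p + 3 * q) (2 * p + 3 * q) (4 * p + 6 * q) (2 * p + 3 * q)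
      (by push_cast; ring) (by push_cast; ring) (by push_cast; ring) (by push_cast; ring)))
    (pair p (p + q) (3 * p + 3 * q) (p + q)
      (by ring) (by push_cast; ring) (by push_cast; ring) (by push_cast; ring)))
    (pair 0 0 p 0
      (by push_cast; ring) (by push_cast; ring) (by ring) (by push_cast; ring)))
    (pair (p + 3 * q) q 0 q
      (by push_cast; ring) (by ring) (by push_cast; ring) (by ring)))
    (pair (3 * p + 6 * q) (p + 3 * q) (p + 3 * q) (p + 3 * q)
      (by push_cast; ring) (by push_cast; ring) (by push_cast; ring) (by push_cast; ring))).trans ?_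
  rw [altSum]
  ring

end Field

end G2

namespace G2

/-! ### Transfer from the generic case -/

section Map

variable {R S : Type*} [CommRing R] [CommRing S] (φ : R →+* S) (t x y : R)

theorem map_decor (C B : Prop) [Decidable C] [Decidable B] : φ (decor t C B) = decor (φ t) C B := by
  simp only [decor, apply_ite φ, map_zero, map_one, map_neg, map_sub]

theorem map_decorSum (N : ℕ) (g : ℕ → R) :
    φ (decorSum t N g) = decorSum (φ t) N fun u => φ (g u) := by
  simp only [decorSum, endWeight, map_sum, map_mul, map_decor]

theorem map_stdSum (p q : ℕ) : φ (stdSum t x y p q) = stdSum (φ t) (φ x) (φ y) p q := by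
  simp only [stdSum, midSum, map_decorSum, map_mul, map_pow, map_sum, map_decor]

theorem map_adjFactor (Ce Pe Cd Pd Bd Ca Pa Ba S' : Prop) :
    φ (adjFactor t Ce Pe Cd Pd Bd Ca Pa Ba S') = adjFactor (φ t) Ce Pe Cd Pd Bd Ca Pa Ba S' := by
  simp only [adjFactor, apply_ite φ, map_zero, map_one, map_neg, map_sub, map_mul, map_pow,
    map_add]

theorem map_adjWeight (p q e d a : ℕ) :
    φ (adjWeight t p q e d a) = adjWeight (φ t) p q e d a :=
  map_adjFactor _ _ _ _ _ _ _ _ _ _ _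

theorem map_adjPart (p q : ℕ) : φ (adjPart t x y p q) = adjPart (φ t) (φ x) (φ y) p q := by
  simp only [adjPart, map_decorSum, map_mul, map_pow, map_sum, map_adjWeight]

theorem map_altSum (p q : ℕ) : φ (altSum x y p q) = altSum (φ x) (φ y) p q := by
  simp only [altSum, map_mul, map_pow, map_add, map_sub, map_one]

theorem map_rootProd : φ (rootProd t x y) = rootProd (φ t) (φ x) (φ y) := by
  simp only [rootProd, map_mul, map_pow, map_sub, map_one]

end Map

/-- The closed forms hold in the fraction field; once multiplied by the root product, both sides
come from A, where the identity is recovered by injectivity. -/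
theorem stdSum_add_adjPart_mul_of_isDomain {A : Type*} [CommRing A] [IsDomain A] (t x y : A)
    (hx : x ≠ 0) (hy : y ≠ 0) (h1 : 1 - x ≠ 0) (h2 : 1 - y ≠ 0) (h3 : 1 - x * y ≠ 0)
    (h4 : 1 - x ^ 3 * y ≠ 0) (h5 : 1 - x ^ 3 * y ^ 2 ≠ 0) (h6 : 1 - x ^ 2 * y ≠ 0)
    (h7 : 1 + x ^ 2 * y ≠ 0) {p q : ℕ} (hp : 0 < p) (hq : 0 < q) :
    (stdSum t x y p q + adjPart t x y p q) * rootProd 1 x y =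
      rootProd t x y * altSum x y p q := by
  let i := algebraMap A (FractionRing A)
  have hi : Function.Injective i := IsFractionRing.injective A (FractionRing A)
  apply hi
  rw [← map_ne_zero_iff i hi] at hx hy h1 h2 h3 h4 h5 h6 h7
  simp only [map_add, map_sub, map_mul, map_pow, map_one] at h1 h2 h3 h4 h5 h6 h7
  have hr : rootProd 1 (i x) (i y) ≠ 0 := by
    simp only [rootProd, one_mul]
    positivity
  simp only [map_mul, map_add, map_stdSum, map_adjPart, map_rootProd, map_altSum, map_one]
  rw [adjPart_eq hy h2, stdSum_add_adjSum hx hy h1 h2 h3 h4 h5 h6 h7 hp hq, div_mul_eq_mul_div,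
    div_mul_cancel₀ _ hr]

/-- The polynomial identity, over an arbitrary commutative ring. -/
theorem stdSum_add_adjPart_mul {R : Type*} [CommRing R] (t x y : R) {p q : ℕ} (hp : 0 < p)
    (hq : 0 < q) :
    (stdSum t x y p q + adjPart t x y p q) * rootProd 1 x y =
      rootProd t x y * altSum x y p q := by
  -- A polynomial with a nonzero value at (2, 2, 2) is nonzero; this settles every side condition
  -- for the indeterminates, including the one on 1 + x²y.
  have ne : ∀ P : MvPolynomial (Fin 3) ℤ, MvPolynomial.eval (fun _ => 2) P ≠ 0 → P ≠ 0 := by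
    rintro _ hP rfl
    exact hP (map_zero _)
  have univ := stdSum_add_adjPart_mul_of_isDomain (A := MvPolynomial (Fin 3) ℤ)
    (.X 2) (.X 0) (.X 1) (ne _ (by simp)) (ne _ (by simp)) (ne _ (by simp)) (ne _ (by simp))
    (ne _ (by simp)) (ne _ (by simp)) (ne _ (by simp)) (ne _ (by simp)) (ne _ (by simp)) hp hq
  have := congrArg (MvPolynomial.eval₂Hom (Int.castRingHom R) ![x, y, t]) univ
  simpa only [map_mul, map_add, map_stdSum, map_adjPart, map_rootProd, map_altSum, map_one,
    MvPolynomial.coe_eval₂Hom, MvPolynomial.eval₂_X, Matrix.cons_val] using this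

/-! ### Return to Ĥ and conclusion -/

namespace Pattern

theorem Hhat_eq {K : Type*} [Field K] (q : K) (ℓ₁ ℓ₂ : ℤ) (π : Pattern) :
    π.Hhat q ℓ₁ ℓ₂ = π.stdWeight (1 / q) ℓ₁ ℓ₂ + π.adjustedWeight (1 / q) ℓ₁ ℓ₂ := by
  have hh : ∀ u, π.h q ℓ₁ ℓ₂ u = @decor K _ (1 / q) (π.Circled u) (π.Boxed ℓ₁ ℓ₂ u)
      (Classical.propDecidable _) (Classical.propDecidable _) := by
    intro u
    simp only [h, decor, neg_div]
  have e1 : (1 - 1 / q) / q = (1 - 1 / q) * (1 / q) := by ring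
  have e2 : -(1 - 1 / q) / q ^ 2 = -((1 - 1 / q) * (1 / q) ^ 2) := by ring
  have e3 : (1 - 1 / q) / q ^ 3 = (1 - 1 / q) * (1 / q) ^ 3 := by ring
  have e4 : (1 - 1 / q) ^ 2 / q = (1 - 1 / q) ^ 2 * (1 / q) := by ring
  have e5 : -(1 - 1 / q) ^ 2 / q ^ 2 = -((1 - 1 / q) ^ 2 * (1 / q) ^ 2) := by ring
  have e6 : (1 - 1 / q) ^ 3 / q = (1 - 1 / q) ^ 3 * (1 / q) := by ring
  rw [Hhat, Hstd, Hadj, stdWeight, adjustedWeight]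
  simp only [hh, Hadj', adjFactor, e1, e2, e3, e4, e5, e6]

end Pattern

theorem one_le_of_isDominant {θ : G2Weight} (hθ : IsDominant θ) {ℓ₁ ℓ₂ : ℤ}
    (hℓ : θ + ρ = ℓ₁ • ϖ₁ + ℓ₂ • ϖ₂) : 1 ≤ ℓ₁ ∧ 1 ≤ ℓ₂ := by
  obtain ⟨h1, h2⟩ := hθ
  rw [coroot₁_apply] at h1
  rw [coroot₂_apply] at h2
  have e1 := congrArg Prod.fst hℓ
  have e2 := congrArg Prod.snd hℓ
  simp [ρ, ϖ₁, ϖ₂] at e1 e2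
  omega

end G2

theorem mainTheorem1 {K : Type*} [Field K] (q x y : K) (hq : q ≠ 0) (hx : x ≠ 0) (hy : y ≠ 0)
    (hroots : ∀ v ∈ G2.posRoots, 1 - G2.monom x y v ≠ 0)
    (θ : G2Weight) (hθ : G2.IsDominant θ) (ℓ₁ ℓ₂ : ℤ)
    (hℓ : θ + G2.ρ = ℓ₁ • G2.ϖ₁ + ℓ₂ • G2.ϖ₂) :
    ∑ π ∈ G2.Pattern.littelmannPatterns ℓ₁ ℓ₂,
        π.Hhat q ℓ₁ ℓ₂ * x ^ (π.a + π.c + π.e) * y ^ (π.b + π.d + π.f) =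
      G2.monom x y (-(G2.longest.1 (θ + G2.ρ))) * G2.D q x y *
        G2.weylQuotient x y (θ + G2.ρ) := by
  obtain ⟨h1, h2⟩ := G2.one_le_of_isDominant hθ hℓ
  lift ℓ₁ to ℕ using by omega
  lift ℓ₂ to ℕ using by omega
  have hw : -(G2.longest.1 (θ + G2.ρ)) = θ + G2.ρ := by
    change - -(θ + G2.ρ) = θ + G2.ρ
    exact neg_neg _
  have hprod : ∏ v ∈ G2.posRoots, (1 - G2.monom x y v) = G2.rootProd 1 x y := by
    simp [G2.posRoots, G2.monom, G2.rootProd]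
    ring
  have hD : G2.D q x y = G2.rootProd (1 / q) x y := by
    simp [G2.D, G2.posRoots, G2.monom, G2.rootProd]
    ring
  have hne : G2.rootProd 1 x y ≠ 0 := by
    rw [← hprod]
    exact Finset.prod_ne_zero_iff.2 hroots
  rw [hw, G2.weylQuotient, hprod, hD, hℓ, mul_div_assoc', eq_div_iff hne, mul_right_comm,
    G2.monom_mul_sum_sgn hx hy, mul_comm (G2.altSum x y ℓ₁ ℓ₂),
    ← G2.stdSum_add_adjPart_mul (1 / q) x y (by omega) (by omega)]
  simp only [G2.Pattern.Hhat_eq, add_mul, Finset.sum_add_distrib]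
  rw [G2.Pattern.sum_stdWeight, G2.Pattern.sum_adjustedWeight _ _ _ _ _ (by omega)]
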